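/- Let $\mathbb D$ be the open unit disc, $\mathbb T$ the unit circle and $m$ normalized Lebesgue measure on $\mathbb T$. For $1<p<\infty$ let $H^p$ be the Hardy space of holomorphic $f:\mathbb D\to\mathbb C$ with $\|f\|_p=\sup_{0\le r<1}\left(\int_{\mathbb T}|f(r\zeta)|^p\,dm(\zeta)\right)^{1/p}<\infty$. Let $1<p<\infty$, let $h\in H^p$ and let $\psi:\mathbb D\to\mathbb D$ be holomorphic, such that the weighted composition operator $W_{h,\psi}f=h\cdot(f\circ\psi)$ is bounded from $H^p$ to $H^p$. Denote the radial boundary functions of $h$ and $\psi$ on $\mathbb T$ (defined $m$-almost everywhere) again by $h$ and $\psi$, and define a Borel measure on $\overline{\mathbb D}$ by $$\mu_{h,\psi}(E)=\int_{\psi^{-1}(E)\cap\mathbb T}|h|^p\,dm .$$ Then the restriction of $\mu_{h,\psi}$ to $\mathbb T$ is absolutely continuous with respect to $m$; and, with $g_{h,\psi}=d(\mu_{h,\psi}|_{\mathbb T})/dm$ its Radon–Nikodym derivative, $W_{h,\psi}$ is bounded below on $H^p$ (there is $\delta>0$ with $\|W_{h,\psi}f\|_p\ge\delta\|f\|_p$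 for all $f\in H^p$) if and only if $g_{h,\psi}$ is essentially bounded away from $0$ on $\mathbb T$ (there is $c>0$ with $g_{h,\psi}\ge c$ $m$-almost everywhere on $\mathbb T$). -/

import Mathlib

open MeasureTheory Filter Topology
open scoped ENNReal NNReal

noncomputable section

namespace HardyDisc

/-- The open unit disc. -/
def disc : Set ℂ := Metric.ball 0 1

/-- The unit circle. -/
def circle : Set ℂ := Metric.sphere 0 1

/-- Normalized Lebesgue measure on the unit circle, as a Borel measure on `ℂ` carried by the
circle: the image of `dt / (2π)` on `(0, 2π]` under `t ↦ exp (i t)`. -/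
def arcMeasure : Measure ℂ :=
  (ENNReal.ofReal (2 * Real.pi))⁻¹ •
    (volume.restrict (Set.Ioc 0 (2 * Real.pi))).map (circleMap 0 1)

/-- The Hardy norm `sup_{0 ≤ r < 1} (∫ |f (r ζ)|^p dm(ζ))^{1/p}`, with value `∞` allowed. It only
depends on the values of `f` on the open unit disc. -/
def hardyNorm (p : ℝ) (f : ℂ → ℂ) : ℝ≥0∞ :=
  ⨆ r ∈ Set.Ico (0 : ℝ) 1, eLpNorm (fun ζ : ℂ => f ((r : ℂ) * ζ)) (ENNReal.ofReal p) arcMeasure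

/-- `f` belongs to the Hardy space `H^p` of the unit disc. -/
def MemHardy (p : ℝ) (f : ℂ → ℂ) : Prop :=
  DifferentiableOn ℂ f disc ∧ hardyNorm p f < ∞

/-- The weighted composition operator `W_{h,ψ} f (z) = h z * f (ψ z)`. -/
def weightedComp (h ψ f : ℂ → ℂ) : ℂ → ℂ := fun z => h z * f (ψ z)

/-- `W_{h,ψ}` is a bounded operator from `H^p` to `H^p`. -/
def IsBoundedOp (p : ℝ) (h ψ : ℂ → ℂ) : Prop :=
  ∃ C : ℝ≥0, ∀ f : ℂ → ℂ, MemHardy p f →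
    MemHardy p (weightedComp h ψ f) ∧ hardyNorm p (weightedComp h ψ f) ≤ C * hardyNorm p f

/-- `W_{h,ψ}` is bounded below on `H^p`. -/
def IsBoundedBelow (p : ℝ) (h ψ : ℂ → ℂ) : Prop :=
  ∃ δ : ℝ≥0, 0 < δ ∧ ∀ f : ℂ → ℂ, MemHardy p f →
    δ * hardyNorm p f ≤ hardyNorm p (weightedComp h ψ f)

/-- The boundary function `ζ ↦ lim_{r → 1⁻} f (r ζ)` on the unit circle. For `f` in a Hardy space
the limit exists at almost every `ζ`; the value elsewhere is irrelevant. -/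
def radialLimit (f : ℂ → ℂ) (ζ : ℂ) : ℂ :=
  limUnder (𝓝[<] (1 : ℝ)) (fun r : ℝ => f ((r : ℂ) * ζ))

/-- The measure `E ↦ ∫_{ψ⁻¹(E) ∩ 𝕋} |h|^p dm`, where `h` and `ψ` on the circle are the boundary
functions. It is carried by the closed unit disc. -/
def pullbackMeasure (p : ℝ) (h ψ : ℂ → ℂ) : Measure ℂ :=
  (arcMeasure.withDensity (fun ζ => ‖radialLimit h ζ‖ₑ ^ p)).map (radialLimit ψ)

/-- The Radon–Nikodym derivative, on the unit circle, of `pullbackMeasure p h ψ` with respect to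
normalized Lebesgue measure. -/
def pullbackDensity (p : ℝ) (h ψ : ℂ → ℂ) : ℂ → ℝ≥0∞ :=
  ((pullbackMeasure p h ψ).restrict circle).rnDeriv arcMeasure

/-- `g` is essentially bounded away from `0` on the unit circle. -/
def EssBoundedAwayFromZero (g : ℂ → ℝ≥0∞) : Prop :=
  ∃ c : ℝ≥0, 0 < c ∧ ∀ᵐ ζ ∂arcMeasure, (c : ℝ≥0∞) ≤ g ζ

end HardyDisc

end

namespace HardyDisc

/-! Write `m` for `arcMeasure` and `μ` for `pullbackMeasure p h ψ`. If `f` is continuous on the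
closed disc and holomorphic inside, the boundary function of `h · (f ∘ ψ)` is `h · (f ∘ ψ)` formed
from boundary values, so `‖W f‖^p = ∫ |f|^p dμ` (`hardyNorm_weightedComp_rpow`). The theorem thus
becomes a comparison of `μ` with `m`, tested on functions `|q|^p` with `q` a polynomial. Such tests
determine inequalities between finite measures on the circle (`measure_le_smul_of_polynomial`): a
trigonometric polynomial is `z^(-n) q(z)`, so on the circle the moduli of polynomials are uniformly
dense among the moduli of continuous functions.

Boundedness of `W` then says `μ ≤ C^p m` on the circle, whence absolute continuity. If `W` is
bounded below by `δ`, replace `q` by `z^n q`: the integral against `m` does not change, while the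
mass of `μ` inside the disc is lost as `n → ∞`. Hence `δ^p m ≤ μ` on the circle. Conversely, `g ≥ c`
gives `∫ |f|^p dμ ≥ c ∫ |f|^p dm` for `f` continuous on the closed disc; a general `f` is the limit
in `H^p` of its dilates, and `W` is continuous.

The supporting Hardy space theory is Fatou's theorem and the `L^p` convergence of dilates. The norms
of the dilates increase to a finite limit, and uniform convexity of `L^p` turns this into the Cauchy
property. The limit has `f` as its Poisson integral, which converges radially at Lebesgue points. -/

/-! ### Normalized arc measure. -/

theorem arcMeasure_ae_norm : ∀ᵐ ζ ∂arcMeasure, ‖ζ‖ = 1 := by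
  refine Measure.ae_smul_measure ?_ _
  rw [ae_map_iff (measurable_circleMap 0 1).aemeasurable
    (measurableSet_eq_fun measurable_norm measurable_const)]
  exact .of_forall fun t => by simp

instance isProbabilityMeasure_arcMeasure : IsProbabilityMeasure arcMeasure := by
  constructor
  have h : ENNReal.ofReal (2 * Real.pi) ≠ 0 := by simp [Real.pi_pos]
  simp only [arcMeasure, Measure.smul_apply, smul_eq_mul]
  rw [Measure.map_apply (measurable_circleMap 0 1) MeasurableSet.univ]
  simp only [Set.preimage_univ, Measure.restrict_apply_univ, Real.volume_Ioc, sub_zero]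
  exact ENNReal.inv_mul_cancel h ENNReal.ofReal_ne_top

theorem measurableSet_circle : MeasurableSet circle := Metric.isClosed_sphere.measurableSet

theorem arcMeasure_restrict_circle : arcMeasure.restrict circle = arcMeasure := by
  rw [Measure.restrict_eq_self_of_ae_mem]
  filter_upwards [arcMeasure_ae_norm] with ζ hζ
  simpa [circle] using hζ

theorem aestronglyMeasurable_of_continuousOn {E : Type*} [TopologicalSpace E]
    [TopologicalSpace.PseudoMetrizableSpace E] {F : ℂ → E} {s : Set ℂ} (hs : circle ⊆ s)
    (hF : ContinuousOn F s) : AEStronglyMeasurable F arcMeasure := by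
  rw [← arcMeasure_restrict_circle]
  exact (hF.mono hs).aestronglyMeasurable_of_isCompact (isCompact_sphere 0 1) measurableSet_circle

theorem integral_arcMeasure {E : Type*} [NormedAddCommGroup E] [NormedSpace ℝ E] {F : ℂ → E}
    (hF : AEStronglyMeasurable F arcMeasure) :
    ∫ ζ, F ζ ∂arcMeasure = Real.circleAverage F 0 1 := by
  have h : ENNReal.ofReal (2 * Real.pi) ≠ 0 := by simp [Real.pi_pos]
  have hF' : AEStronglyMeasurable F
      (Measure.map (circleMap 0 1) (volume.restrict (Set.Ioc 0 (2 * Real.pi)))) := by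
    refine hF.mono_ac (Measure.absolutelyContinuous_smul ?_)
    exact ENNReal.inv_ne_zero.2 ENNReal.ofReal_ne_top
  rw [arcMeasure, integral_smul_measure, integral_map (measurable_circleMap 0 1).aemeasurable hF',
    Real.circleAverage_def, intervalIntegral.integral_of_le (by positivity),
    ENNReal.toReal_inv, ENNReal.toReal_ofReal (by positivity)]

/-! ### The Poisson kernel and contractivity of dilations. -/

/-- The Poisson kernel at the point `r * ζ`, for `ω` on the unit circle. -/
noncomputable def diskKernel (r : ℝ) (ζ ω : ℂ) : ℝ := (1 - r ^ 2) / ‖ω - r * ζ‖ ^ 2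

theorem one_sub_le_norm_sub {r : ℝ} (h0 : 0 ≤ r) {ζ ω : ℂ} (hζ : ‖ζ‖ = 1) (hω : ‖ω‖ = 1) :
    1 - r ≤ ‖ω - r * ζ‖ := by
  have := norm_sub_norm_le ω (r * ζ)
  simpa [hζ, hω, abs_of_nonneg h0] using this

theorem norm_sub_mul_comm (r : ℝ) {ζ ω : ℂ} (hζ : ‖ζ‖ = 1) (hω : ‖ω‖ = 1) :
    ‖ω - r * ζ‖ = ‖ζ - r * ω‖ := by
  have h1 := Complex.sq_norm ζ
  have h2 := Complex.sq_norm ω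
  rw [← sq_eq_sq₀ (norm_nonneg _) (norm_nonneg _), Complex.sq_norm, Complex.sq_norm]
  rw [hζ, Complex.normSq_apply] at h1
  rw [hω, Complex.normSq_apply] at h2
  simp only [Complex.normSq_apply, Complex.sub_re, Complex.sub_im, Complex.re_ofReal_mul,
    Complex.im_ofReal_mul]
  linear_combination (1 - r ^ 2) * h1 - (1 - r ^ 2) * h2

/-- Symmetry gives the kernel mass one in either variable, as the Fubini argument for contractivity
requires. -/
theorem diskKernel_comm (r : ℝ) {ζ ω : ℂ} (hζ : ‖ζ‖ = 1) (hω : ‖ω‖ = 1) :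
    diskKernel r ζ ω = diskKernel r ω ζ := by
  rw [diskKernel, diskKernel, norm_sub_mul_comm r hζ hω]

theorem diskKernel_nonneg {r : ℝ} (h0 : 0 ≤ r) (h1 : r < 1) (ζ ω : ℂ) : 0 ≤ diskKernel r ζ ω :=
  div_nonneg (by nlinarith) (by positivity)

theorem measurable_diskKernel (r : ℝ) : Measurable fun x : ℂ × ℂ => diskKernel r x.1 x.2 := by
  unfold diskKernel
  fun_prop

theorem measurable_diskKernel_right (r : ℝ) (ζ : ℂ) : Measurable (diskKernel r ζ) := by
  unfold diskKernel
  fun_prop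

theorem diskKernel_le {r : ℝ} (h0 : 0 ≤ r) (h1 : r < 1) {ζ ω : ℂ} (hζ : ‖ζ‖ = 1) (hω : ‖ω‖ = 1) :
    diskKernel r ζ ω ≤ 2 / (1 - r) := by
  have h := one_sub_le_norm_sub h0 hζ hω
  have h2 : 0 < 1 - r := by linarith
  rw [diskKernel, div_le_div_iff₀ (pow_pos (h2.trans_le h) 2) h2]
  have : (1 - r) ^ 2 ≤ ‖ω - r * ζ‖ ^ 2 := by gcongr
  nlinarith

theorem integrable_diskKernel_smul {r : ℝ} (h0 : 0 ≤ r) (h1 : r < 1) {ζ : ℂ} (hζ : ‖ζ‖ = 1)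
    {E : Type*} [NormedAddCommGroup E] [NormedSpace ℝ E] {F : ℂ → E}
    (hF : Integrable F arcMeasure) :
    Integrable (fun ω => diskKernel r ζ ω • F ω) arcMeasure := by
  refine hF.bdd_smul (2 / (1 - r)) (measurable_diskKernel_right r ζ).aestronglyMeasurable ?_
  filter_upwards [arcMeasure_ae_norm] with ω hω
  rw [Real.norm_of_nonneg (diskKernel_nonneg h0 h1 ζ ω)]
  exact diskKernel_le h0 h1 hζ hω

/-- The Poisson integral formula on the unit circle. -/
theorem integral_diskKernel_smul {r : ℝ} (h0 : 0 ≤ r) (h1 : r < 1) {ζ : ℂ} (hζ : ‖ζ‖ = 1)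
    {g : ℂ → ℂ} (hg : DiffContOnCl ℂ g disc) :
    ∫ ω, diskKernel r ζ ω • g ω ∂arcMeasure = g (r * ζ) := by
  have hw : (r : ℂ) * ζ ∈ Metric.ball (0 : ℂ) 1 := by
    simpa [hζ, abs_of_nonneg h0] using h1
  have hc : ContinuousOn g (Metric.closedBall 0 1) := by
    have := hg.continuousOn
    rwa [disc, closure_ball _ one_ne_zero] at this
  rw [← hg.circleAverage_poissonKernel_smul hw, integral_arcMeasure]
  · refine Real.circleAverage_congr_sphere fun ω hω => ?_
    have hω : ‖ω‖ = 1 := by simpa using hω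
    simp [diskKernel, poissonKernel_def, hω, hζ]
  · exact (measurable_diskKernel_right r ζ).aestronglyMeasurable.smul
      (aestronglyMeasurable_of_continuousOn Metric.sphere_subset_closedBall hc)

theorem integral_diskKernel {r : ℝ} (h0 : 0 ≤ r) (h1 : r < 1) {ζ : ℂ} (hζ : ‖ζ‖ = 1) :
    ∫ ω, diskKernel r ζ ω ∂arcMeasure = 1 := by
  have h := integral_diskKernel_smul h0 h1 hζ (g := fun _ => 1) diffContOnCl_const
  have h2 : (∫ ω, ((diskKernel r ζ ω : ℝ) : ℂ) ∂arcMeasure) = 1 := by simpa using h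
  rw [integral_complex_ofReal] at h2
  exact_mod_cast h2

theorem lintegral_diskKernel {r : ℝ} (h0 : 0 ≤ r) (h1 : r < 1) {ζ : ℂ} (hζ : ‖ζ‖ = 1) :
    ∫⁻ ω, ENNReal.ofReal (diskKernel r ζ ω) ∂arcMeasure = 1 := by
  rw [← ofReal_integral_eq_lintegral_ofReal _ (.of_forall fun ω => diskKernel_nonneg h0 h1 ζ ω),
    integral_diskKernel h0 h1 hζ, ENNReal.ofReal_one]
  simpa using integrable_diskKernel_smul h0 h1 hζ (F := fun _ => (1 : ℝ)) (integrable_const _)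

/-- Jensen's inequality for the probability measure with density the kernel, obtained from the
monotonicity of `L^p` norms in the exponent. -/
theorem rpow_lintegral_diskKernel_le {p : ℝ} (hp : 1 ≤ p) {r : ℝ} (h0 : 0 ≤ r) (h1 : r < 1)
    {ζ : ℂ} (hζ : ‖ζ‖ = 1) {u : ℂ → ℝ≥0∞} (hu : AEMeasurable u arcMeasure) :
    (∫⁻ ω, ENNReal.ofReal (diskKernel r ζ ω) * u ω ∂arcMeasure) ^ p ≤
      ∫⁻ ω, ENNReal.ofReal (diskKernel r ζ ω) * u ω ^ p ∂arcMeasure := by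
  have hm : Measurable fun ω => ENNReal.ofReal (diskKernel r ζ ω) :=
    (measurable_diskKernel_right r ζ).ennreal_ofReal
  set ν := arcMeasure.withDensity fun ω => ENNReal.ofReal (diskKernel r ζ ω) with hν
  have hac : ν ≪ arcMeasure := withDensity_absolutelyContinuous _ _
  have hprob : IsProbabilityMeasure ν :=
    ⟨by simp [hν, lintegral_diskKernel h0 h1 hζ]⟩
  have e1 : ∀ v : ℂ → ℝ≥0∞, AEMeasurable v arcMeasure →
      ∫⁻ ω, ENNReal.ofReal (diskKernel r ζ ω) * v ω ∂arcMeasure = ∫⁻ ω, v ω ∂ν := fun v hv => by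
    rw [hν, lintegral_withDensity_eq_lintegral_mul₀ hm.aemeasurable hv]
    rfl
  rw [e1 u hu, e1 _ (hu.pow_const p)]
  have h := eLpNorm'_le_eLpNorm'_of_exponent_le (μ := ν) (f := u) one_pos hp
    (hu.mono_ac hac).aestronglyMeasurable
  simp only [eLpNorm', enorm_eq_self, ENNReal.rpow_one, div_one, one_div] at h
  rw [← ENNReal.rpow_le_rpow_iff (inv_pos.2 (by linarith : 0 < p))]
  rwa [ENNReal.rpow_rpow_inv (by linarith)]

theorem lintegral_rpow_lintegral_diskKernel_le {p : ℝ} (hp : 1 ≤ p) {r : ℝ} (h0 : 0 ≤ r)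
    (h1 : r < 1) {u : ℂ → ℝ≥0∞} (hu : AEMeasurable u arcMeasure) :
    ∫⁻ ζ, (∫⁻ ω, ENNReal.ofReal (diskKernel r ζ ω) * u ω ∂arcMeasure) ^ p ∂arcMeasure ≤
      ∫⁻ ω, u ω ^ p ∂arcMeasure := by
  have hm : Measurable fun x : ℂ × ℂ => ENNReal.ofReal (diskKernel r x.1 x.2) :=
    (measurable_diskKernel r).ennreal_ofReal
  calc _ ≤ ∫⁻ ζ, ∫⁻ ω, ENNReal.ofReal (diskKernel r ζ ω) * u ω ^ p ∂arcMeasure ∂arcMeasure := by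
        refine lintegral_mono_ae ?_
        filter_upwards [arcMeasure_ae_norm] with ζ hζ
        exact rpow_lintegral_diskKernel_le hp h0 h1 hζ hu
    _ = ∫⁻ ω, ∫⁻ ζ, ENNReal.ofReal (diskKernel r ζ ω) * u ω ^ p ∂arcMeasure ∂arcMeasure :=
        by
        refine lintegral_lintegral_swap (AEMeasurable.mul hm.aemeasurable ?_)
        exact (hu.pow_const p).comp_snd
    _ = ∫⁻ ω, u ω ^ p ∂arcMeasure := by
        refine lintegral_congr_ae ?_
        filter_upwards [arcMeasure_ae_norm] with ω hω
        have hml : Measurable fun ζ => ENNReal.ofReal (diskKernel r ζ ω) := by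
          unfold diskKernel
          fun_prop
        rw [lintegral_mul_const _ hml]
        have : ∫⁻ ζ, ENNReal.ofReal (diskKernel r ζ ω) ∂arcMeasure = 1 := by
          rw [← lintegral_diskKernel h0 h1 hω]
          refine lintegral_congr_ae ?_
          filter_upwards [arcMeasure_ae_norm] with ζ hζ
          rw [diskKernel_comm r hζ hω]
        rw [this, one_mul]

theorem eLpNorm_ofReal {α E : Type*} [MeasurableSpace α] [NormedAddCommGroup E] {μ : Measure α}
    {p : ℝ} (hp : 1 < p) (f : α → E) :
    eLpNorm f (ENNReal.ofReal p) μ = (∫⁻ x, ‖f x‖ₑ ^ p ∂μ) ^ (1 / p) := by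
  rw [eLpNorm_eq_lintegral_rpow_enorm_toReal (by simp; linarith) ENNReal.ofReal_ne_top,
    ENNReal.toReal_ofReal (by linarith)]

theorem eLpNorm_ofReal_rpow {α E : Type*} [MeasurableSpace α] [NormedAddCommGroup E]
    {μ : Measure α} {p : ℝ} (hp : 1 < p) (f : α → E) :
    eLpNorm f (ENNReal.ofReal p) μ ^ p = ∫⁻ x, ‖f x‖ₑ ^ p ∂μ := by
  rw [eLpNorm_ofReal hp, one_div, ENNReal.rpow_inv_rpow (by linarith)]

/-- Dilations contract the `L^p` norm on the circle. -/
theorem eLpNorm_dilate_le {p : ℝ} (hp : 1 < p) {r : ℝ} (h0 : 0 ≤ r) (h1 : r < 1) {g : ℂ → ℂ}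
    (hg : DiffContOnCl ℂ g disc) :
    eLpNorm (fun ζ : ℂ => g (r * ζ)) (ENNReal.ofReal p) arcMeasure ≤
      eLpNorm g (ENNReal.ofReal p) arcMeasure := by
  have hc : ContinuousOn g (Metric.closedBall 0 1) := by
    have := hg.continuousOn
    rwa [disc, closure_ball _ one_ne_zero] at this
  have hgm : AEStronglyMeasurable g arcMeasure :=
    aestronglyMeasurable_of_continuousOn Metric.sphere_subset_closedBall hc
  rw [eLpNorm_ofReal hp, eLpNorm_ofReal hp]
  gcongr ?_ ^ _
  refine le_trans (lintegral_mono_ae ?_)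
    (lintegral_rpow_lintegral_diskKernel_le hp.le h0 h1 hgm.enorm)
  filter_upwards [arcMeasure_ae_norm] with ζ hζ
  gcongr
  rw [← integral_diskKernel_smul h0 h1 hζ hg]
  refine (enorm_integral_le_lintegral_enorm _).trans_eq (lintegral_congr fun ω => ?_)
  rw [enorm_smul, Real.enorm_of_nonneg (diskKernel_nonneg h0 h1 ζ ω)]

/-! ### Uniform convexity, pointwise. -/

section UniformConvexity

/-- For equal moduli the strictness comes from strict convexity of the norm on `ℂ`; for different
moduli, from strict convexity of `t ↦ t^p`. -/
theorem rpow_norm_midpoint_lt {p : ℝ} (hp : 1 < p) {a b : ℂ} (hab : a ≠ b) :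
    ‖(a + b) / 2‖ ^ p < (‖a‖ ^ p + ‖b‖ ^ p) / 2 := by
  by_cases h : ‖a‖ = ‖b‖
  · have h1 : ‖(1 / 2 : ℝ) • (a + b)‖ < ‖a‖ := (norm_midpoint_lt_iff h).2 hab
    have h2 : (1 / 2 : ℝ) • (a + b) = (a + b) / 2 := by
      rw [Complex.real_smul]; push_cast; ring
    rw [h2] at h1
    rw [← h, add_self_div_two]
    exact Real.rpow_lt_rpow (norm_nonneg _) h1 (by linarith)
  · have h1 := (strictConvexOn_rpow hp).2 (norm_nonneg a) (norm_nonneg b) h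
      (by norm_num : (0 : ℝ) < 1 / 2) (by norm_num : (0 : ℝ) < 1 / 2) (by norm_num)
    simp only [smul_eq_mul] at h1
    have h2 : ‖(a + b) / 2‖ ≤ 1 / 2 * ‖a‖ + 1 / 2 * ‖b‖ := by
      rw [norm_div, Complex.norm_ofNat]
      linarith [norm_add_le a b]
    calc _ ≤ (1 / 2 * ‖a‖ + 1 / 2 * ‖b‖) ^ p := by gcongr
      _ < _ := by linarith

/-- A pointwise form of the uniform convexity of `L^p`. -/
theorem exists_rpow_norm_sub_le {p : ℝ} (hp : 1 < p) {ε : ℝ} (hε : 0 < ε) :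
    ∃ C : ℝ, 0 ≤ C ∧ ∀ a b : ℂ, ‖a - b‖ ^ p ≤
      ε * (‖a‖ ^ p + ‖b‖ ^ p) + C * ((‖a‖ ^ p + ‖b‖ ^ p) / 2 - ‖(a + b) / 2‖ ^ p) := by
  have hp0 : 0 < p := by linarith
  have hcont : ∀ {u : ℂ × ℂ → ℂ}, Continuous u → Continuous fun x => ‖u x‖ ^ p := fun hu =>
    hu.norm.rpow_const fun _ => Or.inr hp0.le
  -- Both sides are homogeneous of degree `p`, so the normalization `|a|^p + |b|^p = 1` suffices. If
  -- `|a - b|^p < ε`, the first term is enough; the remaining pairs form the compact set `S`, on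
  -- which the convexity defect `φ` is positive, so that `|a - b|^p / φ` is bounded.
  set S : Set (ℂ × ℂ) := {x | ‖x.1‖ ^ p + ‖x.2‖ ^ p = 1 ∧ ε ≤ ‖x.1 - x.2‖ ^ p} with hS
  have hSc : IsCompact S := by
    refine (isCompact_closedBall (0 : ℂ × ℂ) 1).of_isClosed_subset ?_ ?_
    · exact (isClosed_eq ((hcont continuous_fst).add (hcont continuous_snd))
        continuous_const).inter
        (isClosed_le continuous_const (hcont (continuous_fst.sub continuous_snd)))
    · rintro ⟨a, b⟩ ⟨h, -⟩
      have ha : 0 ≤ ‖a‖ ^ p := by positivity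
      have hb : 0 ≤ ‖b‖ ^ p := by positivity
      simp only at h
      rw [mem_closedBall_zero_iff, Prod.norm_def, max_le_iff]
      constructor
      · exact le_of_not_gt fun hlt => by linarith [Real.one_lt_rpow hlt hp0]
      · exact le_of_not_gt fun hlt => by linarith [Real.one_lt_rpow hlt hp0]
  set φ : ℂ × ℂ → ℝ := fun x => (‖x.1‖ ^ p + ‖x.2‖ ^ p) / 2 - ‖(x.1 + x.2) / 2‖ ^ p with hφ
  have hφc : Continuous φ := (((hcont continuous_fst).add (hcont continuous_snd)).div_const 2).sub
    (hcont ((continuous_fst.add continuous_snd).div_const 2))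
  have hφ0 : ∀ x, 0 ≤ φ x := by
    rintro ⟨a, b⟩
    by_cases h : a = b
    · simp only [hφ, h, add_self_div_two, sub_self, le_refl]
    · exact (sub_pos.2 (rpow_norm_midpoint_lt hp h)).le
  have hφpos : ∀ x ∈ S, 0 < φ x := by
    rintro ⟨a, b⟩ ⟨-, h⟩
    refine sub_pos.2 (rpow_norm_midpoint_lt hp fun hab => ?_)
    simp only at hab
    simp only [hab, sub_self, norm_zero, Real.zero_rpow hp0.ne'] at h
    linarith
  obtain ⟨C, hC⟩ := hSc.exists_bound_of_continuousOn (f := fun x => ‖x.1 - x.2‖ ^ p / φ x)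
    ((hcont (continuous_fst.sub continuous_snd)).continuousOn.div hφc.continuousOn
      fun x hx => (hφpos x hx).ne')
  have key : ∀ x : ℂ × ℂ, ‖x.1‖ ^ p + ‖x.2‖ ^ p = 1 →
      ‖x.1 - x.2‖ ^ p ≤ ε + max C 0 * φ x := by
    intro x hx
    by_cases h : ε ≤ ‖x.1 - x.2‖ ^ p
    · have h1 := (Real.le_norm_self _).trans (hC x ⟨hx, h⟩)
      rw [div_le_iff₀ (hφpos x ⟨hx, h⟩)] at h1
      have : C * φ x ≤ max C 0 * φ x := mul_le_mul_of_nonneg_right (le_max_left _ _) (hφ0 x)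
      linarith
    · have := mul_nonneg (le_max_right C 0) (hφ0 x)
      linarith
  refine ⟨max C 0, le_max_right _ _, fun a b => ?_⟩
  have ha : 0 ≤ ‖a‖ ^ p := by positivity
  have hb : 0 ≤ ‖b‖ ^ p := by positivity
  rcases (add_nonneg ha hb).eq_or_lt with h | h
  · have ha0 : ‖a‖ ^ p = 0 := by linarith
    have hb0 : ‖b‖ ^ p = 0 := by linarith
    rw [Real.rpow_eq_zero (norm_nonneg _) hp0.ne', norm_eq_zero] at ha0 hb0
    simp [ha0, hb0, Real.zero_rpow hp0.ne']
  · set s := ‖a‖ ^ p + ‖b‖ ^ p with hs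
    set t : ℝ := s ^ p⁻¹ with ht
    have htp : 0 < t := Real.rpow_pos_of_pos h _
    have htt : t ^ p = s := Real.rpow_inv_rpow h.le hp0.ne'
    have hscale : ∀ z : ℂ, ‖z / (t : ℂ)‖ ^ p = ‖z‖ ^ p / s := fun z => by
      rw [norm_div, Complex.norm_real, Real.norm_of_nonneg htp.le,
        Real.div_rpow (norm_nonneg _) htp.le, htt]
    have h1 := key (a / t, b / t) (by
      simp only [hscale]
      rw [← add_div, div_self h.ne'])
    have e1 : a / (t : ℂ) - b / t = (a - b) / t := by ring
    have e2 : (a / (t : ℂ) + b / t) / 2 = ((a + b) / 2) / t := by ring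
    simp only [hφ, e1, e2, hscale] at h1
    have h2 := mul_le_mul_of_nonneg_left h1 h.le
    have e3 : s * (‖a - b‖ ^ p / s) = ‖a - b‖ ^ p := by field_simp
    have e4 : s * (ε + max C 0 * ((‖a‖ ^ p / s + ‖b‖ ^ p / s) / 2 - ‖(a + b) / 2‖ ^ p / s)) =
      ε * s + max C 0 * (s / 2 - ‖(a + b) / 2‖ ^ p) := by
      rw [← add_div, ← hs]
      field_simp
    linarith

end UniformConvexity

/-! ### Integral means of dilates. -/

theorem mul_mem_disc {r : ℝ} (h0 : 0 ≤ r) (h1 : r < 1) {z : ℂ} (hz : ‖z‖ ≤ 1) :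
    (r : ℂ) * z ∈ disc := by
  rw [disc, mem_ball_zero_iff, norm_mul, Complex.norm_real, Real.norm_of_nonneg h0]
  nlinarith [norm_nonneg z]

theorem diffContOnCl_dilate {f : ℂ → ℂ} (hf : DifferentiableOn ℂ f disc) {r : ℝ} (h0 : 0 ≤ r)
    (h1 : r < 1) : DiffContOnCl ℂ (fun z => f (r * z)) disc := by
  refine DifferentiableOn.diffContOnCl ?_
  rw [disc, closure_ball _ one_ne_zero]
  refine hf.comp ((differentiable_id.const_mul _).differentiableOn) fun z hz => ?_
  exact mul_mem_disc h0 h1 (by simpa using hz)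

theorem continuousOn_closedBall_of_diffContOnCl {g : ℂ → ℂ} (hg : DiffContOnCl ℂ g disc) :
    ContinuousOn g (Metric.closedBall 0 1) := by
  have := hg.continuousOn
  rwa [disc, closure_ball _ one_ne_zero] at this

theorem continuousOn_circle_of_diffContOnCl {g : ℂ → ℂ} (hg : DiffContOnCl ℂ g disc) :
    ContinuousOn g circle :=
  (continuousOn_closedBall_of_diffContOnCl hg).mono Metric.sphere_subset_closedBall

theorem exists_bound_on_circle {g : ℂ → ℂ} (hg : ContinuousOn g circle) :
    ∃ B, ∀ᵐ ζ ∂arcMeasure, ‖g ζ‖ ≤ B := by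
  obtain ⟨B, hB⟩ := (isCompact_sphere (0 : ℂ) 1).exists_bound_of_continuousOn hg
  refine ⟨B, ?_⟩
  filter_upwards [arcMeasure_ae_norm] with ζ hζ
  exact hB ζ (by simpa using hζ)

theorem memLp_of_continuousOn {g : ℂ → ℂ} (hg : ContinuousOn g circle) (q : ℝ≥0∞) :
    MemLp g q arcMeasure := by
  obtain ⟨B, hB⟩ := exists_bound_on_circle hg
  exact MemLp.of_bound (aestronglyMeasurable_of_continuousOn subset_rfl hg) B hB

theorem integrable_rpow_norm {p : ℝ} (hp : 1 < p) {μ : Measure ℂ} {g : ℂ → ℂ}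
    (hg : MemLp g (ENNReal.ofReal p) μ) : Integrable (fun ζ => ‖g ζ‖ ^ p) μ := by
  have := hg.integrable_norm_rpow (by simp; linarith) ENNReal.ofReal_ne_top
  rwa [ENNReal.toReal_ofReal (by linarith)] at this

theorem eLpNorm_rpow_eq_ofReal_integral {p : ℝ} (hp : 1 < p) {μ : Measure ℂ} {g : ℂ → ℂ}
    (hg : MemLp g (ENNReal.ofReal p) μ) :
    eLpNorm g (ENNReal.ofReal p) μ ^ p = ENNReal.ofReal (∫ ζ, ‖g ζ‖ ^ p ∂μ) := by
  rw [eLpNorm_ofReal_rpow hp, ofReal_integral_eq_lintegral_ofReal (integrable_rpow_norm hp hg)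
    (.of_forall fun ζ => by positivity)]
  refine lintegral_congr fun ζ => ?_
  rw [← ofReal_norm, ENNReal.ofReal_rpow_of_nonneg (norm_nonneg _) (by linarith)]

theorem eLpNorm_dilate_mono {p : ℝ} (hp : 1 < p) {f : ℂ → ℂ} (hf : DifferentiableOn ℂ f disc)
    {r s : ℝ} (h0 : 0 ≤ r) (hrs : r ≤ s) (h1 : s < 1) :
    eLpNorm (fun ζ : ℂ => f (r * ζ)) (ENNReal.ofReal p) arcMeasure ≤
      eLpNorm (fun ζ : ℂ => f (s * ζ)) (ENNReal.ofReal p) arcMeasure := by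
  rcases hrs.eq_or_lt with rfl | hlt
  · rfl
  have hs : 0 < s := h0.trans_lt hlt
  have h := eLpNorm_dilate_le hp (div_nonneg h0 hs.le) ((div_lt_one hs).2 hlt)
    (diffContOnCl_dilate hf hs.le h1)
  have e : ∀ ζ : ℂ, (s : ℂ) * (((r / s : ℝ) : ℂ) * ζ) = r * ζ := fun ζ => by
    have : (s : ℂ) ≠ 0 := by exact_mod_cast hs.ne'
    push_cast
    field_simp
  simpa only [e] using h

theorem eLpNorm_dilate_le_hardyNorm {p : ℝ} {f : ℂ → ℂ} {r : ℝ} (h0 : 0 ≤ r) (h1 : r < 1) :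
    eLpNorm (fun ζ : ℂ => f (r * ζ)) (ENNReal.ofReal p) arcMeasure ≤ hardyNorm p f :=
  le_iSup₂ (f := fun (r : ℝ) (_ : r ∈ Set.Ico (0 : ℝ) 1) =>
    eLpNorm (fun ζ : ℂ => f (r * ζ)) (ENNReal.ofReal p) arcMeasure) r ⟨h0, h1⟩

/-- Radii increasing to `1`. -/
noncomputable def radius (n : ℕ) : ℝ := 1 - 1 / ((n : ℝ) + 1)

theorem radius_nonneg (n : ℕ) : 0 ≤ radius n := by
  rw [radius, sub_nonneg, div_le_one (by positivity)]
  linarith [n.cast_nonneg (α := ℝ)]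

theorem radius_lt_one (n : ℕ) : radius n < 1 := by
  rw [radius, sub_lt_self_iff]
  positivity

theorem tendsto_radius : Tendsto radius atTop (𝓝 1) := by
  have h := (tendsto_one_div_add_atTop_nhds_zero_nat (𝕜 := ℝ)).const_sub 1
  rwa [sub_zero] at h

theorem monotone_radius : Monotone radius := fun n k h => by
  unfold radius
  gcongr

theorem tendsto_eLpNorm_radius {p : ℝ} (hp : 1 < p) {f : ℂ → ℂ}
    (hf : DifferentiableOn ℂ f disc) :
    Tendsto (fun n => eLpNorm (fun ζ : ℂ => f (radius n * ζ)) (ENNReal.ofReal p) arcMeasure)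
      atTop (𝓝 (hardyNorm p f)) := by
  have hmono : Monotone fun n =>
      eLpNorm (fun ζ : ℂ => f (radius n * ζ)) (ENNReal.ofReal p) arcMeasure := fun n k h =>
    eLpNorm_dilate_mono hp hf (radius_nonneg n) (monotone_radius h) (radius_lt_one k)
  convert tendsto_atTop_iSup hmono using 2
  refine le_antisymm (iSup₂_le fun r hr => ?_)
    (iSup_le fun n => eLpNorm_dilate_le_hardyNorm (radius_nonneg n) (radius_lt_one n))
  obtain ⟨n, hn⟩ := (tendsto_radius.eventually (lt_mem_nhds hr.2)).exists
  exact (eLpNorm_dilate_mono hp hf hr.1 hn.le (radius_lt_one n)).trans (le_iSup_of_le n le_rfl)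

theorem memLp_dilate {f : ℂ → ℂ} (hf : DifferentiableOn ℂ f disc) {r : ℝ} (h0 : 0 ≤ r)
    (h1 : r < 1) (q : ℝ≥0∞) : MemLp (fun ζ : ℂ => f (r * ζ)) q arcMeasure :=
  memLp_of_continuousOn (continuousOn_circle_of_diffContOnCl (diffContOnCl_dilate hf h0 h1)) q

theorem integral_rpow_dilate_le {p : ℝ} (hp : 1 < p) {r : ℝ} (h0 : 0 ≤ r) (h1 : r < 1) {g : ℂ → ℂ}
    (hg : DiffContOnCl ℂ g disc) :
    ∫ ζ, ‖g (r * ζ)‖ ^ p ∂arcMeasure ≤ ∫ ζ, ‖g ζ‖ ^ p ∂arcMeasure := by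
  have h := ENNReal.rpow_le_rpow (eLpNorm_dilate_le hp h0 h1 hg) (by linarith : 0 ≤ p)
  rw [eLpNorm_rpow_eq_ofReal_integral hp (memLp_dilate hg.differentiableOn h0 h1 _),
    eLpNorm_rpow_eq_ofReal_integral hp (memLp_of_continuousOn
      (continuousOn_circle_of_diffContOnCl hg) _)] at h
  exact (ENNReal.ofReal_le_ofReal_iff (integral_nonneg fun ζ => by positivity)).1 h

/-- A further dilation by `ρ < 1` keeps all arguments in a compact disc, where `f` is bounded, so
dominated convergence applies. The limit bounds from below the norms of midpoints of two dilates. -/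
theorem tendsto_integral_rpow_average {p : ℝ} (hp : 1 < p) {f : ℂ → ℂ}
    (hf : DifferentiableOn ℂ f disc) {ρ : ℝ} (h0 : 0 ≤ ρ) (h1 : ρ < 1) :
    Tendsto (fun x : ℕ × ℕ => ∫ ζ, ‖(f (radius x.1 * (ρ * ζ)) + f (radius x.2 * (ρ * ζ))) / 2‖ ^ p
      ∂arcMeasure) atTop (𝓝 (∫ ζ, ‖f (ρ * ζ)‖ ^ p ∂arcMeasure)) := by
  have hK : IsCompact (Metric.closedBall (0 : ℂ) ρ) := isCompact_closedBall 0 ρ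
  have hsub : Metric.closedBall (0 : ℂ) ρ ⊆ disc := Metric.closedBall_subset_ball h1
  obtain ⟨B, hB⟩ := hK.exists_bound_of_continuousOn (hf.continuousOn.mono hsub)
  have hmem : ∀ (n : ℕ) (ζ : ℂ), ‖ζ‖ = 1 → (radius n : ℂ) * (ρ * ζ) ∈ Metric.closedBall 0 ρ := by
    intro n ζ hζ
    rw [mem_closedBall_zero_iff, norm_mul, norm_mul, Complex.norm_real, Complex.norm_real, hζ,
      Real.norm_of_nonneg h0, Real.norm_of_nonneg (radius_nonneg n)]
    nlinarith [radius_lt_one n]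
  refine tendsto_integral_filter_of_dominated_convergence (fun _ => B ^ p) ?_ ?_
    (integrable_const _) ?_
  · refine .of_forall fun x => ?_
    have hd : ∀ n : ℕ, DiffContOnCl ℂ (fun z : ℂ => f (radius n * (ρ * z))) disc := fun n =>
      diffContOnCl_dilate (f := fun z => f (radius n * z))
        (diffContOnCl_dilate hf (radius_nonneg n) (radius_lt_one n)).differentiableOn h0 h1
    have hc : ContinuousOn (fun ζ : ℂ => (f (radius x.1 * (ρ * ζ)) + f (radius x.2 * (ρ * ζ))) / 2)
        circle := ((continuousOn_circle_of_diffContOnCl (hd x.1)).add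
          (continuousOn_circle_of_diffContOnCl (hd x.2))).div_const 2
    exact aestronglyMeasurable_of_continuousOn subset_rfl
      (hc.norm.rpow_const fun _ _ => Or.inr (by linarith))
  · refine .of_forall fun x => ?_
    filter_upwards [arcMeasure_ae_norm] with ζ hζ
    rw [Real.norm_of_nonneg (by positivity)]
    have h2 := hB _ (hmem x.1 ζ hζ)
    have h3 := hB _ (hmem x.2 ζ hζ)
    gcongr
    rw [norm_div, Complex.norm_ofNat]
    linarith [norm_add_le (f (radius x.1 * (ρ * ζ))) (f (radius x.2 * (ρ * ζ)))]
  · filter_upwards [arcMeasure_ae_norm] with ζ hζ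
    have hz : (ρ : ℂ) * ζ ∈ disc := mul_mem_disc h0 h1 hζ.le
    have hfc : ContinuousAt f (ρ * ζ) := hf.continuousOn.continuousAt (Metric.isOpen_ball.mem_nhds hz)
    have ht : Tendsto (fun n => f (radius n * (ρ * ζ))) atTop (𝓝 (f (ρ * ζ))) := by
      refine hfc.tendsto.comp ?_
      have := ((Complex.continuous_ofReal.tendsto 1).comp tendsto_radius).mul_const ((ρ : ℂ) * ζ)
      simpa using this
    rw [← prod_atTop_atTop_eq]
    have hx := ((ht.comp (tendsto_fst (g := (atTop : Filter ℕ)))).add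
      (ht.comp (tendsto_snd (f := (atTop : Filter ℕ))))).div_const 2
    rw [add_self_div_two] at hx
    exact (hx.norm).rpow_const (Or.inr (by linarith))

/-- The `p`-th power means of the dilates increase to `M`. The midpoint of two late dilates has mean
at least that of its own dilation by a fixed radius, which is nearly `M`. So the convexity defect is
small in the mean, and the difference must be small. -/
theorem MemHardy.cauchy_radius {p : ℝ} (hp : 1 < p) {f : ℂ → ℂ} (hf : MemHardy p f) {ε : ℝ}
    (hε : 0 < ε) : ∃ N, ∀ n ≥ N, ∀ k ≥ N,
      ∫ ζ, ‖f (radius n * ζ) - f (radius k * ζ)‖ ^ p ∂arcMeasure ≤ ε := by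
  have hp0 : 0 < p := by linarith
  set M : ℝ := (hardyNorm p f ^ p).toReal with hM
  have hfin : hardyNorm p f ^ p ≠ ∞ := ENNReal.rpow_ne_top_of_nonneg hp0.le hf.2.ne
  have hM0 : 0 ≤ M := ENNReal.toReal_nonneg
  have hle : ∀ n, ∫ ζ, ‖f (radius n * ζ)‖ ^ p ∂arcMeasure ≤ M := fun n => by
    have h := ENNReal.rpow_le_rpow (eLpNorm_dilate_le_hardyNorm (p := p) (f := f)
      (radius_nonneg n) (radius_lt_one n)) hp0.le
    rw [eLpNorm_rpow_eq_ofReal_integral hp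
      (memLp_dilate hf.1 (radius_nonneg n) (radius_lt_one n) _)] at h
    exact (ENNReal.ofReal_le_iff_le_toReal hfin).1 h
  have hlim : Tendsto (fun n => ∫ ζ, ‖f (radius n * ζ)‖ ^ p ∂arcMeasure) atTop (𝓝 M) := by
    have h := (ENNReal.tendsto_toReal hfin).comp
      ((ENNReal.continuous_rpow_const (y := p)).tendsto _ |>.comp (tendsto_eLpNorm_radius hp hf.1))
    refine h.congr fun n => ?_
    simp only [Function.comp_apply]
    rw [eLpNorm_rpow_eq_ofReal_integral hp
      (memLp_dilate hf.1 (radius_nonneg n) (radius_lt_one n) _),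
      ENNReal.toReal_ofReal (integral_nonneg fun ζ => by positivity)]
  -- The constants give each of the two terms of the final estimate at most `ε / 2`: the first is
  -- `2M · ε / (4(M + 1))`, the second `C · η`. The added ones avoid division by zero.
  obtain ⟨C, hC0, hC⟩ := exists_rpow_norm_sub_le hp (ε := ε / (4 * (M + 1))) (by positivity)
  set η : ℝ := ε / (2 * (C + 1)) with hη
  have hη0 : 0 < η := by positivity
  obtain ⟨m, hm⟩ := (hlim.eventually (lt_mem_nhds (sub_lt_self M hη0))).exists
  have hev := (tendsto_integral_rpow_average hp hf.1 (radius_nonneg m)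
    (radius_lt_one m)).eventually (lt_mem_nhds hm)
  obtain ⟨⟨N₁, N₂⟩, hN⟩ := eventually_atTop.1 hev
  refine ⟨max N₁ N₂, fun n hn k hk => ?_⟩
  have hn' := hN (n, k) ⟨(le_max_left _ _).trans hn, (le_max_right _ _).trans hk⟩
  have hd : ∀ n : ℕ, DiffContOnCl ℂ (fun z : ℂ => f (radius n * z)) disc := fun n =>
    diffContOnCl_dilate hf.1 (radius_nonneg n) (radius_lt_one n)
  have havg : DiffContOnCl ℂ (fun z : ℂ => (f (radius n * z) + f (radius k * z)) / 2) disc := by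
    have h := ((hd n).add (hd k)).const_smul ((2 : ℂ)⁻¹)
    convert h using 2 with z
    simp only [Pi.smul_apply, Pi.add_apply, smul_eq_mul]
    ring
  have h2 := integral_rpow_dilate_le hp (radius_nonneg m) (radius_lt_one m) havg
  have hmn := memLp_dilate hf.1 (radius_nonneg n) (radius_lt_one n) (ENNReal.ofReal p)
  have hmk := memLp_dilate hf.1 (radius_nonneg k) (radius_lt_one k) (ENNReal.ofReal p)
  have i1 := integrable_rpow_norm hp hmn
  have i2 := integrable_rpow_norm hp hmk
  have i3 := integrable_rpow_norm hp (memLp_of_continuousOn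
    (continuousOn_circle_of_diffContOnCl havg) (ENNReal.ofReal p))
  have i4 := integrable_rpow_norm hp (hmn.sub hmk)
  calc ∫ ζ, ‖f (radius n * ζ) - f (radius k * ζ)‖ ^ p ∂arcMeasure
      ≤ ∫ ζ, ((ε / (4 * (M + 1))) * (‖f (radius n * ζ)‖ ^ p + ‖f (radius k * ζ)‖ ^ p) +
          C * ((‖f (radius n * ζ)‖ ^ p + ‖f (radius k * ζ)‖ ^ p) / 2 -
            ‖(f (radius n * ζ) + f (radius k * ζ)) / 2‖ ^ p)) ∂arcMeasure :=
        integral_mono i4 (((i1.add i2).const_mul _).add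
          ((((i1.add i2).div_const 2).sub i3).const_mul C)) fun ζ => hC _ _
    _ = (ε / (4 * (M + 1))) * ((∫ ζ, ‖f (radius n * ζ)‖ ^ p ∂arcMeasure) +
          ∫ ζ, ‖f (radius k * ζ)‖ ^ p ∂arcMeasure) +
          C * (((∫ ζ, ‖f (radius n * ζ)‖ ^ p ∂arcMeasure) +
          ∫ ζ, ‖f (radius k * ζ)‖ ^ p ∂arcMeasure) / 2 -
          ∫ ζ, ‖(f (radius n * ζ) + f (radius k * ζ)) / 2‖ ^ p ∂arcMeasure) := by
        have i5 : Integrable (fun ζ : ℂ => ‖f (radius n * ζ)‖ ^ p + ‖f (radius k * ζ)‖ ^ p)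
          arcMeasure := i1.add i2
        have i6 : Integrable (fun ζ : ℂ => (‖f (radius n * ζ)‖ ^ p + ‖f (radius k * ζ)‖ ^ p) / 2 -
            ‖(f (radius n * ζ) + f (radius k * ζ)) / 2‖ ^ p) arcMeasure := (i5.div_const 2).sub i3
        rw [integral_add (i5.const_mul _) (i6.const_mul C), integral_const_mul, integral_const_mul,
          integral_sub (i5.div_const 2) i3, integral_div, integral_add i1 i2]
    _ ≤ (ε / (4 * (M + 1))) * (M + M) + C * ((M + M) / 2 - (M - η)) := by
        have := hle n
        have := hle k
        gcongr
        exact hn'.le.trans h2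
    _ = ε / 2 * (M / (M + 1)) + ε / 2 * (C / (C + 1)) := by
        rw [hη]
        field_simp
        ring
    _ ≤ ε / 2 * 1 + ε / 2 * 1 := by
        gcongr
        · exact (div_le_one (by positivity)).2 (by linarith)
        · exact (div_le_one (by positivity)).2 (by linarith)
    _ = ε := by ring

/-! ### Boundary functions and their Poisson integrals. -/

/-- The dilates of a function in the Hardy space converge in `L^p` of the circle. -/
theorem MemHardy.exists_boundary {p : ℝ} (hp : 1 < p) {f : ℂ → ℂ} (hf : MemHardy p f) :
    ∃ F : ℂ → ℂ, MemLp F (ENNReal.ofReal p) arcMeasure ∧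
      Tendsto (fun n => eLpNorm (fun ζ : ℂ => f (radius n * ζ) - F ζ) (ENNReal.ofReal p) arcMeasure)
        atTop (𝓝 0) := by
  have hp0 : 0 < p := by linarith
  have : Fact (1 ≤ ENNReal.ofReal p) := ⟨by simpa using hp.le⟩
  have hmn := fun n => memLp_dilate hf.1 (radius_nonneg n) (radius_lt_one n) (ENNReal.ofReal p)
  set u : ℕ → Lp ℂ (ENNReal.ofReal p) arcMeasure := fun n => (hmn n).toLp _ with hu
  have hcau : CauchySeq u := by
    rw [Metric.cauchySeq_iff]
    intro ε hε
    obtain ⟨N, hN⟩ := hf.cauchy_radius hp (ε := (ε / 2) ^ p) (by positivity)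
    refine ⟨N, fun n hn k hk => ?_⟩
    rw [Lp.dist_edist, hu, Lp.edist_toLp_toLp]
    have h := eLpNorm_rpow_eq_ofReal_integral hp ((hmn n).sub (hmn k))
    have h2 : eLpNorm ((fun ζ : ℂ => f (radius n * ζ)) - fun ζ : ℂ => f (radius k * ζ))
        (ENNReal.ofReal p) arcMeasure ≤ ENNReal.ofReal (ε / 2) := by
      rw [← ENNReal.rpow_le_rpow_iff hp0, h, ENNReal.ofReal_rpow_of_nonneg (by positivity) hp0.le]
      exact ENNReal.ofReal_le_ofReal (hN n hn k hk)
    refine (ENNReal.toReal_mono ENNReal.ofReal_ne_top h2).trans_lt ?_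
    rw [ENNReal.toReal_ofReal (by positivity)]
    linarith
  obtain ⟨F, hF⟩ := cauchySeq_tendsto_of_complete hcau
  refine ⟨F, Lp.memLp F, ?_⟩
  have h := (Lp.tendsto_Lp_iff_tendsto_eLpNorm' u F).1 hF
  refine h.congr fun n => eLpNorm_congr_ae ?_
  filter_upwards [(hmn n).coeFn_toLp] with ζ hζ
  simp only [Pi.sub_apply, hu]
  rw [hζ]

/-- Each dilate satisfies the Poisson formula. For fixed `r` the kernel is bounded, so `L^p`
convergence on the circle passes to the limit under the integral, while the values inside converge
by continuity. -/
theorem hasPoissonRepresentation {p : ℝ} (hp : 1 < p) {f F : ℂ → ℂ}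
    (hf : DifferentiableOn ℂ f disc) (hF : MemLp F (ENNReal.ofReal p) arcMeasure)
    (hlim : Tendsto (fun n => eLpNorm (fun ζ : ℂ => f (radius n * ζ) - F ζ) (ENNReal.ofReal p)
      arcMeasure) atTop (𝓝 0)) {r : ℝ} (h0 : 0 ≤ r) (h1 : r < 1) {ζ : ℂ} (hζ : ‖ζ‖ = 1) :
    ∫ ω, diskKernel r ζ ω • F ω ∂arcMeasure = f (r * ζ) := by
  have hp1 : (1 : ℝ≥0∞) ≤ ENNReal.ofReal p := by simpa using hp.le
  have hmn := fun n => memLp_dilate hf (radius_nonneg n) (radius_lt_one n) (ENNReal.ofReal p)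
  have hlim1 : Tendsto (fun n => ∫ ω, diskKernel r ζ ω • f (radius n * ω) ∂arcMeasure) atTop
      (𝓝 (∫ ω, diskKernel r ζ ω • F ω ∂arcMeasure)) := by
    refine tendsto_integral_of_L1' _ (integrable_diskKernel_smul h0 h1 hζ (hF.integrable hp1)).1
      (.of_forall fun n => integrable_diskKernel_smul h0 h1 hζ ((hmn n).integrable hp1)) ?_
    have hc : Tendsto (fun n => ENNReal.ofReal (2 / (1 - r)) *
        eLpNorm (fun ζ : ℂ => f (radius n * ζ) - F ζ) (ENNReal.ofReal p) arcMeasure) atTop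
        (𝓝 0) := by
      simpa using ENNReal.Tendsto.const_mul hlim (Or.inr ENNReal.ofReal_ne_top)
    refine tendsto_of_tendsto_of_tendsto_of_le_of_le tendsto_const_nhds hc (fun _ => zero_le)
      fun n => ?_
    have hae : ∀ᵐ ω ∂arcMeasure, ‖((fun ω : ℂ => diskKernel r ζ ω • f (radius n * ω)) -
        fun ω => diskKernel r ζ ω • F ω) ω‖ ≤ 2 / (1 - r) * ‖f (radius n * ω) - F ω‖ := by
      filter_upwards [arcMeasure_ae_norm] with ω hω
      rw [Pi.sub_apply, ← smul_sub, norm_smul,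
        Real.norm_of_nonneg (diskKernel_nonneg h0 h1 ζ ω)]
      gcongr
      exact diskKernel_le h0 h1 hζ hω
    refine (eLpNorm_le_mul_eLpNorm_of_ae_le_mul hae 1).trans ?_
    gcongr
    exact eLpNorm_le_eLpNorm_of_exponent_le hp1 ((hmn n).sub hF).aestronglyMeasurable
  have hz : (r : ℂ) * ζ ∈ disc := mul_mem_disc h0 h1 hζ.le
  have hlim2 : Tendsto (fun n => f (radius n * (r * ζ))) atTop (𝓝 (f (r * ζ))) := by
    refine (hf.continuousOn.continuousAt (Metric.isOpen_ball.mem_nhds hz)).tendsto.comp ?_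
    have := ((Complex.continuous_ofReal.tendsto 1).comp tendsto_radius).mul_const ((r : ℂ) * ζ)
    simpa using this
  refine tendsto_nhds_unique hlim1 (hlim2.congr fun n => ?_)
  exact (integral_diskKernel_smul h0 h1 hζ
    (diffContOnCl_dilate hf (radius_nonneg n) (radius_lt_one n))).symm

/-! ### Fatou's theorem by dyadic decomposition at Lebesgue points. -/

theorem norm_sub_le_two_mul {r : ℝ} (h0 : 0 ≤ r) (h1 : r < 1) {ζ ω : ℂ} (hζ : ‖ζ‖ = 1)
    (hω : ‖ω‖ = 1) : ‖ω - ζ‖ ≤ 2 * ‖ω - r * ζ‖ := by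
  have h2 := one_sub_le_norm_sub h0 hζ hω
  have h3 : ‖(r : ℂ) * ζ - ζ‖ = 1 - r := by
    rw [← sub_one_mul, norm_mul, hζ, mul_one, ← Complex.ofReal_one, ← Complex.ofReal_sub,
      Complex.norm_real, Real.norm_eq_abs, abs_sub_comm, abs_of_nonneg (by linarith)]
  have h4 := norm_add_le (ω - r * ζ) ((r : ℂ) * ζ - ζ)
  rw [sub_add_sub_cancel] at h4
  linarith

/-- The kernel with `r = 1 - t` has mass one and is at least `1 / (4t)` on this ball. -/
theorem arcMeasure_closedBall_le {ζ : ℂ} (hζ : ‖ζ‖ = 1) {t : ℝ} (ht : 0 < t) :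
    arcMeasure (Metric.closedBall ζ t) ≤ ENNReal.ofReal (4 * t) := by
  rcases le_or_gt 1 t with h | h
  · refine prob_le_one.trans ?_
    rw [ENNReal.one_le_ofReal]
    linarith
  have h0 : 0 ≤ 1 - t := by linarith
  have h1 : 1 - t < 1 := by linarith
  have hB : MeasurableSet (Metric.closedBall ζ t) := Metric.isClosed_closedBall.measurableSet
  have key : ENNReal.ofReal (1 / (4 * t)) * arcMeasure (Metric.closedBall ζ t) ≤ 1 := by
    rw [← lintegral_diskKernel h0 h1 hζ, ← setLIntegral_const]
    refine (lintegral_mono_ae ?_).trans (setLIntegral_le_lintegral _ _)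
    rw [ae_restrict_iff' hB]
    filter_upwards [arcMeasure_ae_norm] with ω hω hωB
    refine ENNReal.ofReal_le_ofReal ?_
    have h2 := one_sub_le_norm_sub h0 hζ hω
    have h3 : ‖ω - (1 - t : ℝ) * ζ‖ ≤ 2 * t := by
      have h4 := norm_add_le (ω - ζ) ((t : ℂ) * ζ)
      rw [norm_mul, hζ, Complex.norm_real, Real.norm_of_nonneg ht.le] at h4
      have h5 : ω - ζ + (t : ℂ) * ζ = ω - (1 - t : ℝ) * ζ := by push_cast; ring
      rw [h5] at h4
      have h6 : ‖ω - ζ‖ ≤ t := by simpa [dist_eq_norm] using hωB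
      linarith
    have h7 : 0 < ‖ω - (1 - t : ℝ) * ζ‖ := by linarith
    have h8 : ‖ω - (1 - t : ℝ) * ζ‖ ^ 2 ≤ (2 * t) ^ 2 := by gcongr
    rw [diskKernel, div_le_div_iff₀ (by positivity) (by positivity)]
    nlinarith
  have h2 : ENNReal.ofReal (1 / (4 * t)) = (ENNReal.ofReal (4 * t))⁻¹ := by
    rw [one_div, ENNReal.ofReal_inv_of_pos (by positivity)]
  rw [h2, mul_comm, ← div_eq_mul_inv] at key
  have := (ENNReal.div_le_iff (by simpa using ht) ENNReal.ofReal_ne_top).1 key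
  rwa [one_mul] at this

theorem diskKernel_le_of_two_pow {r : ℝ} (h0 : 0 ≤ r) (h1 : r < 1) {ζ ω : ℂ} (hζ : ‖ζ‖ = 1)
    (hω : ‖ω‖ = 1) : ∃ k : ℕ, ω ∈ Metric.closedBall ζ (2 ^ k * (1 - r)) ∧
      diskKernel r ζ ω ≤ 32 / (4 ^ k * (1 - r)) := by
  have hη : 0 < 1 - r := by linarith
  have h2 := one_sub_le_norm_sub h0 hζ hω
  have h3 := norm_sub_le_two_mul h0 h1 hζ hω
  by_cases hsmall : ‖ω - ζ‖ ≤ 1 - r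
  · refine ⟨0, by simpa [dist_eq_norm] using hsmall, (diskKernel_le h0 h1 hζ hω).trans ?_⟩
    rw [pow_zero, one_mul]
    gcongr
    norm_num
  · have hx : 1 ≤ ‖ω - ζ‖ / (1 - r) := by
      rw [one_le_div hη]
      linarith
    obtain ⟨k, hk1, hk2⟩ := exists_nat_pow_near hx (one_lt_two (α := ℝ))
    rw [le_div_iff₀ hη] at hk1
    rw [div_lt_iff₀ hη] at hk2
    -- The lower bound `2^k (1 - r)` on the distance gives the kernel bound `8 / (4^k (1 - r))`; the
    -- ball containing `ω` has index `k + 1`, and `8 · 4 = 32`.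
    refine ⟨k + 1, by simpa [dist_eq_norm] using hk2.le, ?_⟩
    have h4 : 2 ^ k * (1 - r) ≤ 2 * ‖ω - r * ζ‖ := hk1.trans h3
    have h5 : (2 ^ k * (1 - r)) ^ 2 ≤ (2 * ‖ω - r * ζ‖) ^ 2 := by gcongr
    have h6 : (0 : ℝ) < 4 ^ k := by positivity
    have h7 : ((2 : ℝ) ^ k) ^ 2 = 4 ^ k := by
      rw [← pow_mul, mul_comm, pow_mul]
      norm_num
    rw [mul_pow, h7, mul_pow] at h5
    have h8 : 1 - r ^ 2 ≤ 2 * (1 - r) := by nlinarith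
    rw [diskKernel, div_le_div_iff₀ (pow_pos (hη.trans_le h2) 2) (by positivity)]
    calc (1 - r ^ 2) * (4 ^ (k + 1) * (1 - r)) ≤ 2 * (1 - r) * (4 ^ (k + 1) * (1 - r)) := by gcongr
      _ = 8 * (4 ^ k * (1 - r) ^ 2) := by ring
      _ ≤ 8 * (2 ^ 2 * ‖ω - r * ζ‖ ^ 2) := by gcongr
      _ = 32 * ‖ω - r * ζ‖ ^ 2 := by ring

/-- The Poisson integral of an integrable function converges radially at its Lebesgue points. -/
theorem ae_tendsto_integral_diskKernel {F : ℂ → ℂ} (hF : Integrable F arcMeasure) :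
    ∀ᵐ ζ ∂arcMeasure, Tendsto (fun r : ℝ => ∫ ω, diskKernel r ζ ω • F ω ∂arcMeasure)
      (𝓝[<] 1) (𝓝 (F ζ)) := by
  filter_upwards [arcMeasure_ae_norm,
    (Besicovitch.vitaliFamily arcMeasure).ae_tendsto_lintegral_enorm_sub_div
      hF.locallyIntegrable] with ζ hζ hleb
  replace hleb := hleb.comp (Besicovitch.tendsto_filterAt arcMeasure ζ)
  set I : ℝ → ℝ≥0∞ := fun t => ∫⁻ ω in Metric.closedBall ζ t, ‖F ω - F ζ‖ₑ ∂arcMeasure with hI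
  set J : ℝ≥0∞ := ∫⁻ ω, ‖F ω - F ζ‖ₑ ∂arcMeasure with hJ
  have hJtop : J ≠ ∞ := (hF.sub (integrable_const (F ζ))).2.ne
  have hIJ : ∀ t, I t ≤ J := fun t => setLIntegral_le_lintegral _ _
  -- Dividing by the radius instead of the measure of the ball costs a factor of at most 4 and makes
  -- the scaling explicit in the dyadic sum.
  set A : ℝ → ℝ≥0∞ := fun t => I t / ENNReal.ofReal t with hA
  have hAle : ∀ t, 0 < t → A t ≤ 4 * (I t / arcMeasure (Metric.closedBall ζ t)) := by
    intro t ht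
    have ht' : ENNReal.ofReal t ≠ 0 := by simpa using ht
    rw [hA]
    refine (ENNReal.div_le_iff ht' ENNReal.ofReal_ne_top).2 ?_
    by_cases hB : arcMeasure (Metric.closedBall ζ t) = 0
    · have : I t = 0 := by
        simp only [hI]
        exact setLIntegral_measure_zero _ _ hB
      rw [this]
      exact zero_le
    · calc I t = I t / arcMeasure (Metric.closedBall ζ t) * arcMeasure (Metric.closedBall ζ t) :=
            (ENNReal.div_mul_cancel hB (measure_ne_top _ _)).symm
        _ ≤ I t / arcMeasure (Metric.closedBall ζ t) * ENNReal.ofReal (4 * t) := by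
            gcongr
            exact arcMeasure_closedBall_le hζ ht
        _ = _ := by
            rw [ENNReal.ofReal_mul (by norm_num), ENNReal.ofReal_ofNat]
            ring
  have hA0 : Tendsto A (𝓝[>] 0) (𝓝 0) := by
    have h4 : Tendsto (fun t => 4 * (I t / arcMeasure (Metric.closedBall ζ t))) (𝓝[>] 0) (𝓝 0) := by
      simpa using ENNReal.Tendsto.const_mul hleb (Or.inr ENNReal.ofNat_ne_top)
    refine tendsto_of_tendsto_of_tendsto_of_le_of_le' tendsto_const_nhds h4
      (.of_forall fun _ => zero_le) ?_
    filter_upwards [self_mem_nhdsWithin] with t ht using hAle t ht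
  -- A bound over all radii serves as dominating constant: near zero it comes from the limit, and
  -- beyond `δ` from the total integral `J`.
  obtain ⟨B, hBtop, hB⟩ : ∃ B : ℝ≥0∞, B ≠ ∞ ∧ ∀ t, 0 < t → A t ≤ B := by
    have h1 := hA0.eventually (gt_mem_nhds (zero_lt_one (α := ℝ≥0∞)))
    obtain ⟨δ, hδ, h2⟩ := mem_nhdsGT_iff_exists_Ioo_subset.1 h1
    have hδ' : ENNReal.ofReal δ ≠ 0 := by simpa using hδ
    refine ⟨1 + J / ENNReal.ofReal δ, by simp [ENNReal.div_eq_top, hδ', hJtop], fun t ht => ?_⟩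
    rcases lt_or_ge t δ with h | h
    · exact (le_of_lt (h2 ⟨ht, h⟩)).trans le_self_add
    · refine le_trans ?_ le_add_self
      rw [hA]
      exact ENNReal.div_le_div (hIJ t) (ENNReal.ofReal_le_ofReal h)
  -- Since `32 / (4^k (1 - r)) = (32 / 2^k) / (2^k (1 - r))`, the `k`-th ball contributes a summable
  -- weight times `A` at its radius. Dominated convergence for counting measure then lets the sum
  -- tend to zero term by term.
  have hsum : Tendsto (fun r : ℝ => ∑' k : ℕ, (ENNReal.ofReal (32 / 2 ^ k) * A (2 ^ k * (1 - r))))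
      (𝓝[<] 1) (𝓝 0) := by
    have hz : (0 : ℝ≥0∞) = ∫⁻ _ : ℕ, 0 ∂Measure.count := by simp
    simp_rw [← lintegral_count]
    rw [hz]
    refine tendsto_lintegral_filter_of_dominated_convergence
      (fun k : ℕ => ENNReal.ofReal (32 / 2 ^ k) * B) (.of_forall fun r => measurable_of_countable _)
      ?_ ?_ ?_
    · filter_upwards [self_mem_nhdsWithin] with r hr
      have hr : r < 1 := hr
      refine .of_forall fun k => ?_
      have hpos : 0 < 2 ^ k * (1 - r) := mul_pos (by positivity) (sub_pos.2 hr)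
      gcongr
      exact hB _ hpos
    · rw [lintegral_count, ENNReal.tsum_mul_right]
      refine ENNReal.mul_ne_top ?_ hBtop
      have hs : Summable fun k : ℕ => (32 : ℝ) / 2 ^ k := by
        simpa [div_eq_mul_inv] using
          (summable_geometric_of_lt_one (by norm_num) (by norm_num : (2⁻¹ : ℝ) < 1)).mul_left 32
      rw [← ENNReal.ofReal_tsum_of_nonneg (fun k => by positivity) hs]
      exact ENNReal.ofReal_ne_top
    · refine .of_forall fun k => ?_
      have ht : Tendsto (fun r : ℝ => 2 ^ k * (1 - r)) (𝓝[<] 1) (𝓝[>] 0) := by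
        refine tendsto_nhdsWithin_iff.2 ⟨?_, ?_⟩
        · have hc : Continuous fun r : ℝ => 2 ^ k * (1 - r) := by fun_prop
          have := hc.tendsto 1
          rw [sub_self, mul_zero] at this
          exact this.mono_left nhdsWithin_le_nhds
        · filter_upwards [self_mem_nhdsWithin] with r hr
          have hr : r < 1 := hr
          exact Set.mem_Ioi.2 (mul_pos (by positivity) (sub_pos.2 hr))
      simpa using ENNReal.Tendsto.const_mul (hA0.comp ht) (Or.inr ENNReal.ofReal_ne_top)
  rw [tendsto_iff_edist_tendsto_0]
  refine tendsto_of_tendsto_of_tendsto_of_le_of_le' tendsto_const_nhds hsum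
    (.of_forall fun _ => zero_le) ?_
  filter_upwards [Ioo_mem_nhdsLT (zero_lt_one (α := ℝ))] with r hr
  have h0 := hr.1.le
  have h1 := hr.2
  have hη : 0 < 1 - r := by linarith
  have hsub : (∫ ω, diskKernel r ζ ω • F ω ∂arcMeasure) - F ζ =
      ∫ ω, diskKernel r ζ ω • (F ω - F ζ) ∂arcMeasure := by
    simp_rw [smul_sub]
    rw [integral_sub (integrable_diskKernel_smul h0 h1 hζ hF)
      (integrable_diskKernel_smul h0 h1 hζ (integrable_const _)), integral_smul_const,
      integral_diskKernel h0 h1 hζ, one_smul]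
  rw [edist_eq_enorm_sub, hsub]
  calc _ ≤ ∫⁻ ω, ‖diskKernel r ζ ω • (F ω - F ζ)‖ₑ ∂arcMeasure := enorm_integral_le_lintegral_enorm _
    _ ≤ ∫⁻ ω, ∑' k : ℕ, (Metric.closedBall ζ (2 ^ k * (1 - r))).indicator
          (fun ω => ENNReal.ofReal (32 / (4 ^ k * (1 - r))) * ‖F ω - F ζ‖ₑ) ω ∂arcMeasure := by
        refine lintegral_mono_ae ?_
        filter_upwards [arcMeasure_ae_norm] with ω hω
        obtain ⟨k, hk1, hk2⟩ := diskKernel_le_of_two_pow h0 h1 hζ hω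
        refine le_trans ?_ (ENNReal.le_tsum k)
        rw [Set.indicator_of_mem hk1, enorm_smul,
          Real.enorm_of_nonneg (diskKernel_nonneg h0 h1 ζ ω)]
        gcongr
    _ = ∑' k : ℕ, (ENNReal.ofReal (32 / 2 ^ k) * A (2 ^ k * (1 - r))) := by
        have hm : AEMeasurable (fun ω => ‖F ω - F ζ‖ₑ) arcMeasure :=
          (hF.aestronglyMeasurable.sub aestronglyMeasurable_const).enorm
        rw [lintegral_tsum fun k => (hm.const_mul _).indicator Metric.isClosed_closedBall.measurableSet]
        refine tsum_congr fun k => ?_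
        rw [lintegral_indicator Metric.isClosed_closedBall.measurableSet,
          lintegral_const_mul'' _ hm.restrict]
        have h4 : (4 : ℝ) ^ k = 2 ^ k * 2 ^ k := by
          rw [← mul_pow]
          norm_num
        have hpos : 0 < 2 ^ k * (1 - r) := by positivity
        have e : (32 : ℝ) / (4 ^ k * (1 - r)) = 32 / 2 ^ k * (2 ^ k * (1 - r))⁻¹ := by
          rw [h4]
          field_simp
        rw [e, ENNReal.ofReal_mul (by positivity), ENNReal.ofReal_inv_of_pos hpos, mul_assoc,
          ← ENNReal.div_eq_inv_mul]

/-- Fatou's theorem for the Hardy space. -/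
theorem MemHardy.fatou {p : ℝ} (hp : 1 < p) {f : ℂ → ℂ} (hf : MemHardy p f) :
    (∀ᵐ ζ ∂arcMeasure, Tendsto (fun r : ℝ => f (r * ζ)) (𝓝[<] 1) (𝓝 (radialLimit f ζ))) ∧
    MemLp (radialLimit f) (ENNReal.ofReal p) arcMeasure ∧
    Tendsto (fun n => eLpNorm (fun ζ : ℂ => f (radius n * ζ) - radialLimit f ζ)
      (ENNReal.ofReal p) arcMeasure) atTop (𝓝 0) := by
  obtain ⟨F, hF, hlim⟩ := hf.exists_boundary hp
  have hp1 : (1 : ℝ≥0∞) ≤ ENNReal.ofReal p := by simpa using hp.le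
  have hrad : ∀ᵐ ζ ∂arcMeasure, Tendsto (fun r : ℝ => f (r * ζ)) (𝓝[<] 1) (𝓝 (F ζ)) := by
    filter_upwards [arcMeasure_ae_norm, ae_tendsto_integral_diskKernel (hF.integrable hp1)]
      with ζ hζ h
    refine h.congr' ?_
    filter_upwards [Ioo_mem_nhdsLT (zero_lt_one (α := ℝ))] with r hr
    exact hasPoissonRepresentation hp hf.1 hF hlim hr.1.le hr.2 hζ
  have hae : ∀ᵐ ζ ∂arcMeasure, radialLimit f ζ = F ζ := by
    filter_upwards [hrad] with ζ h using h.limUnder_eq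
  refine ⟨?_, hF.ae_eq (hae.mono fun ζ h => h.symm), hlim.congr fun n => eLpNorm_congr_ae ?_⟩
  · filter_upwards [hrad, hae] with ζ h1 h2
    rwa [h2]
  · filter_upwards [hae] with ζ h
    rw [h]

theorem MemHardy.ae_tendsto {p : ℝ} (hp : 1 < p) {f : ℂ → ℂ} (hf : MemHardy p f) :
    ∀ᵐ ζ ∂arcMeasure, Tendsto (fun r : ℝ => f (r * ζ)) (𝓝[<] 1) (𝓝 (radialLimit f ζ)) :=
  (hf.fatou hp).1

theorem MemHardy.memLp_radialLimit {p : ℝ} (hp : 1 < p) {f : ℂ → ℂ} (hf : MemHardy p f) :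
    MemLp (radialLimit f) (ENNReal.ofReal p) arcMeasure :=
  (hf.fatou hp).2.1

/-- By the triangle inequality, `L^p` convergence of the dilates forces their norms to converge to
that of the boundary function; these norms also tend to the Hardy norm. -/
theorem MemHardy.eLpNorm_radialLimit {p : ℝ} (hp : 1 < p) {f : ℂ → ℂ} (hf : MemHardy p f) :
    eLpNorm (radialLimit f) (ENNReal.ofReal p) arcMeasure = hardyNorm p f := by
  obtain ⟨-, hL, hlim⟩ := hf.fatou hp
  have hp1 : (1 : ℝ≥0∞) ≤ ENNReal.ofReal p := by simpa using hp.le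
  have hm := fun n => memLp_dilate hf.1 (radius_nonneg n) (radius_lt_one n) (ENNReal.ofReal p)
  refine tendsto_nhds_unique ?_ (tendsto_eLpNorm_radius hp hf.1)
  refine tendsto_of_tendsto_of_tendsto_of_le_of_le
    (g := fun n => eLpNorm (radialLimit f) (ENNReal.ofReal p) arcMeasure -
      eLpNorm (fun ζ : ℂ => f (radius n * ζ) - radialLimit f ζ) (ENNReal.ofReal p) arcMeasure)
    (h := fun n => eLpNorm (radialLimit f) (ENNReal.ofReal p) arcMeasure +
      eLpNorm (fun ζ : ℂ => f (radius n * ζ) - radialLimit f ζ) (ENNReal.ofReal p) arcMeasure)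
    ?_ ?_ (fun n => ?_) fun n => ?_
  · simpa using ENNReal.Tendsto.sub tendsto_const_nhds hlim (Or.inl hL.2.ne)
  · simpa using tendsto_const_nhds.add hlim
  · rw [tsub_le_iff_right]
    have h := eLpNorm_sub_le (hm n).1 ((hm n).sub hL).1 hp1
    have e : ((fun ζ : ℂ => f (radius n * ζ)) -
        ((fun ζ : ℂ => f (radius n * ζ)) - radialLimit f)) = radialLimit f := sub_sub_cancel _ _
    rw [e] at h
    exact h
  · have h := eLpNorm_add_le hL.1 ((hm n).sub hL).1 hp1
    have e : (radialLimit f + ((fun ζ : ℂ => f (radius n * ζ)) - radialLimit f)) =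
        fun ζ : ℂ => f (radius n * ζ) := add_sub_cancel _ _
    rw [e] at h
    exact h

/-! ### Moduli of polynomials as test functions on the circle. -/

instance compactSpace_circle : CompactSpace circle :=
  isCompact_iff_compactSpace.1 (isCompact_sphere (0 : ℂ) 1)

theorem norm_of_mem_circle (z : circle) : ‖(z : ℂ)‖ = 1 := by simpa [circle] using z.2

/-- On the circle `conj z = z⁻¹`, so a power of `z` clears all conjugates from a polynomial in `z`
and `conj z`. -/
theorem exists_polynomial_of_mem_starClosure {g : C(circle, ℂ)}
    (hg : g ∈ (polynomialFunctions circle).starClosure) :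
    ∃ (n : ℕ) (q : Polynomial ℂ), ∀ z : circle, g z * (z : ℂ) ^ n = q.eval (z : ℂ) := by
  rw [polynomialFunctions.starClosure_eq_adjoin_X] at hg
  induction hg using Algebra.adjoin_induction with
  | mem f hf =>
    rcases hf with hf | hf
    · refine ⟨0, Polynomial.X, fun z => ?_⟩
      rw [Set.mem_singleton_iff.1 hf]
      simp
    · refine ⟨1, 1, fun z => ?_⟩
      rw [Set.mem_star, Set.mem_singleton_iff, star_eq_iff_star_eq] at hf
      rw [← hf]
      simp [← Complex.normSq_eq_conj_mul_self, Complex.normSq_eq_norm_sq, norm_of_mem_circle z]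
  | algebraMap r => exact ⟨0, Polynomial.C r, fun z => by simp⟩
  | add f₁ f₂ _ _ h₁ h₂ =>
    obtain ⟨n, q₁, h₁⟩ := h₁
    obtain ⟨k, q₂, h₂⟩ := h₂
    refine ⟨n + k, q₁ * Polynomial.X ^ k + q₂ * Polynomial.X ^ n, fun z => ?_⟩
    simp only [ContinuousMap.add_apply, Polynomial.eval_add, Polynomial.eval_mul,
      Polynomial.eval_pow, Polynomial.eval_X, ← h₁, ← h₂]
    ring
  | mul f₁ f₂ _ _ h₁ h₂ =>
    obtain ⟨n, q₁, h₁⟩ := h₁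
    obtain ⟨k, q₂, h₂⟩ := h₂
    refine ⟨n + k, q₁ * q₂, fun z => ?_⟩
    simp only [ContinuousMap.mul_apply, Polynomial.eval_mul, ← h₁, ← h₂]
    ring

/-- The moduli of polynomials approximate the moduli of all continuous functions on the circle. -/
theorem exists_polynomial_norm_near (g : C(circle, ℂ)) {ε : ℝ} (hε : 0 < ε) :
    ∃ q : Polynomial ℂ, ∀ z : circle, |‖q.eval (z : ℂ)‖ - ‖g z‖| ≤ ε := by
  -- Stone–Weierstrass; the factor `z^n` then disappears from the modulus.
  have h := polynomialFunctions.starClosure_topologicalClosure circle ▸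
    StarSubalgebra.mem_top (R := ℂ) (x := g)
  rw [← SetLike.mem_coe, StarSubalgebra.topologicalClosure_coe, Metric.mem_closure_iff] at h
  obtain ⟨f, hf, hfg⟩ := h ε hε
  obtain ⟨n, q, hq⟩ := exists_polynomial_of_mem_starClosure hf
  refine ⟨q, fun z => ?_⟩
  have h1 : ‖q.eval (z : ℂ)‖ = ‖f z‖ := by
    rw [← hq, norm_mul, norm_pow, norm_of_mem_circle, one_pow, mul_one]
  rw [h1]
  refine (abs_norm_sub_norm_le _ _).trans ?_
  rw [← dist_eq_norm, dist_comm]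
  exact (ContinuousMap.dist_apply_le_dist z).trans hfg.le

theorem tendsto_lintegral_rpow_polynomial {p : ℝ} (hp : 0 < p) {α : Measure ℂ} [IsFiniteMeasure α]
    (hα : ∀ᵐ z ∂α, ‖z‖ = 1) {φ : ℂ → ℝ≥0} (hφ : Continuous φ) {q : ℕ → Polynomial ℂ}
    (hq : ∀ (n : ℕ) (z : ℂ), ‖z‖ = 1 →
      |‖(q n).eval z‖ - (φ z : ℝ) ^ p⁻¹| ≤ 1 / ((n : ℝ) + 1)) :
    Tendsto (fun n => ∫⁻ z, ‖(q n).eval z‖ₑ ^ p ∂α) atTop (𝓝 (∫⁻ z, φ z ∂α)) := by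
  obtain ⟨B, hB⟩ := (isCompact_sphere (0 : ℂ) 1).exists_bound_of_continuousOn
    (f := fun z => (φ z : ℝ) ^ p⁻¹)
    (((NNReal.continuous_coe.comp hφ).rpow_const fun _ => Or.inr (by positivity)).continuousOn)
  refine tendsto_lintegral_of_dominated_convergence (fun _ => ENNReal.ofReal (B + 1) ^ p)
    (fun n => (q n).continuous.measurable.enorm.pow_const p) (fun n => ?_) ?_ ?_
  · filter_upwards [hα] with z hz
    gcongr
    rw [← ofReal_norm]
    refine ENNReal.ofReal_le_ofReal ?_
    have h1 := (abs_le.1 (hq n z hz)).2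
    have h2 := (Real.le_norm_self _).trans (hB z (by simpa using hz))
    have h3 : 1 / ((n : ℝ) + 1) ≤ 1 := by
      rw [div_le_one (by positivity)]
      linarith [n.cast_nonneg (α := ℝ)]
    linarith
  · rw [lintegral_const]
    exact ENNReal.mul_ne_top (ENNReal.rpow_ne_top_of_nonneg hp.le ENNReal.ofReal_ne_top)
      (measure_ne_top _ _)
  · filter_upwards [hα] with z hz
    have h1 : Tendsto (fun n => ‖(q n).eval z‖) atTop (𝓝 ((φ z : ℝ) ^ p⁻¹)) := by
      rw [tendsto_iff_norm_sub_tendsto_zero]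
      exact squeeze_zero (fun _ => norm_nonneg _) (fun n => hq n z hz)
        tendsto_one_div_add_atTop_nhds_zero_nat
    have h2 := (ENNReal.continuous_rpow_const (y := p)).tendsto _ |>.comp
      ((ENNReal.continuous_ofReal.tendsto _).comp h1)
    have e : ENNReal.ofReal ((φ z : ℝ) ^ p⁻¹) ^ p = φ z := by
      rw [ENNReal.ofReal_rpow_of_nonneg (by positivity) hp.le,
        Real.rpow_inv_rpow (NNReal.coe_nonneg _) hp.ne', ENNReal.ofReal_coe_nnreal]
    rw [e] at h2
    refine h2.congr fun n => ?_
    simp [ofReal_norm]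

/-- Finite measures on the circle are compared by testing on moduli of polynomials. -/
theorem measure_le_smul_of_polynomial {p : ℝ} (hp : 0 < p) {α β : Measure ℂ} [IsFiniteMeasure α]
    [IsFiniteMeasure β] (hα : ∀ᵐ z ∂α, ‖z‖ = 1) (hβ : ∀ᵐ z ∂β, ‖z‖ = 1) {K : ℝ≥0}
    (h : ∀ q : Polynomial ℂ, ∫⁻ z, ‖q.eval z‖ₑ ^ p ∂α ≤ K * ∫⁻ z, ‖q.eval z‖ₑ ^ p ∂β) :
    α ≤ K • β := by
  have hcont : ∀ φ : ℂ → ℝ≥0, Continuous φ → ∫⁻ z, φ z ∂α ≤ K * ∫⁻ z, φ z ∂β := by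
    intro φ hφ
    -- The root is taken so that `|q|^p` approximates `φ` when `|q|` approximates `|g|`.
    let g : C(circle, ℂ) := ⟨fun z => (((φ z : ℝ) ^ p⁻¹ : ℝ) : ℂ), by
      refine Complex.continuous_ofReal.comp (Continuous.rpow_const ?_ fun _ =>
        Or.inr (by positivity))
      exact NNReal.continuous_coe.comp (hφ.comp continuous_subtype_val)⟩
    choose q hq using fun n : ℕ =>
      exists_polynomial_norm_near g (ε := 1 / ((n : ℝ) + 1)) (by positivity)
    have hq' : ∀ (n : ℕ) (z : ℂ), ‖z‖ = 1 →
        |‖(q n).eval z‖ - (φ z : ℝ) ^ p⁻¹| ≤ 1 / ((n : ℝ) + 1) := fun n z hz => by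
      have h1 := hq n ⟨z, by simpa [circle] using hz⟩
      simp only [g, ContinuousMap.coe_mk, Complex.norm_real] at h1
      rwa [Real.norm_of_nonneg (by positivity)] at h1
    exact le_of_tendsto_of_tendsto' (tendsto_lintegral_rpow_polynomial hp hα hφ hq')
      (ENNReal.Tendsto.const_mul (tendsto_lintegral_rpow_polynomial hp hβ hφ hq')
        (Or.inr ENNReal.coe_ne_top)) fun n => h (q n)
  -- Closed sets are reached through thickened indicators, and Borel sets through inner regularity.
  have hclosed : ∀ F : Set ℂ, IsClosed F → α F ≤ K * β F := by
    intro F hF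
    have hpos : ∀ n : ℕ, 0 < 1 / ((n : ℝ) + 1) := fun n => by positivity
    have hlim : Tendsto (fun n : ℕ => 1 / ((n : ℝ) + 1)) atTop (𝓝 0) :=
      tendsto_one_div_add_atTop_nhds_zero_nat
    exact le_of_tendsto_of_tendsto'
      (tendsto_lintegral_thickenedIndicator_of_isClosed α hF hpos hlim)
      (ENNReal.Tendsto.const_mul (tendsto_lintegral_thickenedIndicator_of_isClosed β hF hpos hlim)
        (Or.inr ENNReal.coe_ne_top)) fun n => hcont _ (thickenedIndicator (hpos n) F).continuous
  refine Measure.le_iff.2 fun s hs => ?_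
  rw [hs.measure_eq_iSup_isClosed_of_ne_top (measure_ne_top _ _)]
  refine iSup₂_le fun F hFs => iSup_le fun hF => (hclosed F hF).trans ?_
  rw [Measure.smul_apply, ENNReal.smul_def, smul_eq_mul]
  gcongr

/-! ### Functions continuous up to the boundary. -/

theorem memHardy_of_diffContOnCl {p : ℝ} (hp : 1 < p) {g : ℂ → ℂ} (hg : DiffContOnCl ℂ g disc) :
    MemHardy p g :=
  ⟨hg.differentiableOn, (iSup₂_le fun _ hr => eLpNorm_dilate_le hp hr.1 hr.2 hg).trans_lt
    (memLp_of_continuousOn (continuousOn_circle_of_diffContOnCl hg) _).2⟩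

theorem tendsto_mul_nhdsLT (ζ : ℂ) (hζ : ‖ζ‖ = 1) :
    Tendsto (fun r : ℝ => (r : ℂ) * ζ) (𝓝[<] 1) (𝓝[disc] ζ) := by
  refine tendsto_nhdsWithin_iff.2 ⟨?_, ?_⟩
  · have hc : Continuous fun r : ℝ => (r : ℂ) * ζ := by fun_prop
    have := hc.tendsto 1
    rw [Complex.ofReal_one, one_mul] at this
    exact this.mono_left nhdsWithin_le_nhds
  · filter_upwards [Ioo_mem_nhdsLT (zero_lt_one (α := ℝ))] with r hr
    exact mul_mem_disc hr.1.le hr.2 hζ.le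

theorem radialLimit_of_diffContOnCl {g : ℂ → ℂ} (hg : DiffContOnCl ℂ g disc) {ζ : ℂ}
    (hζ : ‖ζ‖ = 1) : radialLimit g ζ = g ζ := by
  have hc := (continuousOn_closedBall_of_diffContOnCl hg) ζ (by simpa using hζ.le)
  exact ((hc.mono_left (nhdsWithin_mono _ Metric.ball_subset_closedBall)).comp
    (tendsto_mul_nhdsLT ζ hζ)).limUnder_eq

theorem hardyNorm_of_diffContOnCl {p : ℝ} (hp : 1 < p) {g : ℂ → ℂ} (hg : DiffContOnCl ℂ g disc) :
    hardyNorm p g = eLpNorm g (ENNReal.ofReal p) arcMeasure := by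
  rw [← (memHardy_of_diffContOnCl hp hg).eLpNorm_radialLimit hp]
  refine eLpNorm_congr_ae ?_
  filter_upwards [arcMeasure_ae_norm] with ζ hζ using radialLimit_of_diffContOnCl hg hζ

theorem memHardy_of_mapsTo {p : ℝ} {ψ : ℂ → ℂ} (hψ : DifferentiableOn ℂ ψ disc)
    (hmaps : Set.MapsTo ψ disc disc) : MemHardy p ψ := by
  refine ⟨hψ, (iSup₂_le fun r hr => ?_).trans_lt ENNReal.one_lt_top⟩
  have hb : ∀ᵐ ζ ∂arcMeasure, ‖ψ (r * ζ)‖ ≤ 1 := by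
    filter_upwards [arcMeasure_ae_norm] with ζ hζ
    simpa using (mem_ball_zero_iff.1 (hmaps (mul_mem_disc hr.1 hr.2 hζ.le))).le
  refine (eLpNorm_le_of_ae_bound hb).trans ?_
  simp

/-! ### The pullback measure and the change of variables. -/

section Pullback

variable {p : ℝ} {h ψ : ℂ → ℂ}

theorem aemeasurable_boundary_weight (hp : 1 < p) (hh : MemHardy p h) :
    AEMeasurable (fun ζ => ‖radialLimit h ζ‖ₑ ^ p) arcMeasure :=
  (hh.memLp_radialLimit hp).1.enorm.pow_const p

theorem aemeasurable_radialLimit (hp : 1 < p) (hψ : MemHardy p ψ) :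
    AEMeasurable (radialLimit ψ) (arcMeasure.withDensity fun ζ => ‖radialLimit h ζ‖ₑ ^ p) :=
  (hψ.memLp_radialLimit hp).1.aemeasurable.mono_ac (withDensity_absolutelyContinuous _ _)

theorem isFiniteMeasure_pullbackMeasure (hp : 1 < p) (hh : MemHardy p h) :
    IsFiniteMeasure (pullbackMeasure p h ψ) := by
  have : IsFiniteMeasure (arcMeasure.withDensity fun ζ => ‖radialLimit h ζ‖ₑ ^ p) := by
    refine isFiniteMeasure_withDensity ?_
    rw [← eLpNorm_ofReal_rpow hp]
    exact ENNReal.rpow_ne_top_of_nonneg (by linarith) (hh.memLp_radialLimit hp).2.ne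
  rw [pullbackMeasure]
  infer_instance

theorem ae_radialLimit_mem_closedBall (hp : 1 < p) (hψ : DifferentiableOn ℂ ψ disc)
    (hmaps : Set.MapsTo ψ disc disc) :
    ∀ᵐ ζ ∂arcMeasure, radialLimit ψ ζ ∈ Metric.closedBall (0 : ℂ) 1 := by
  filter_upwards [arcMeasure_ae_norm, (memHardy_of_mapsTo hψ hmaps).ae_tendsto hp] with ζ hζ hlim
  refine Metric.isClosed_closedBall.mem_of_tendsto hlim ?_
  filter_upwards [Ioo_mem_nhdsLT (zero_lt_one (α := ℝ))] with r hr
  exact Metric.ball_subset_closedBall (hmaps (mul_mem_disc hr.1.le hr.2 hζ.le))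

theorem pullbackMeasure_ae_mem_closedBall (hp : 1 < p) (hψ : DifferentiableOn ℂ ψ disc)
    (hmaps : Set.MapsTo ψ disc disc) :
    ∀ᵐ z ∂pullbackMeasure p h ψ, z ∈ Metric.closedBall (0 : ℂ) 1 := by
  refine (ae_map_iff (aemeasurable_radialLimit hp (memHardy_of_mapsTo hψ hmaps))
    Metric.isClosed_closedBall.measurableSet).2 ?_
  exact (withDensity_absolutelyContinuous _ _).ae_le (ae_radialLimit_mem_closedBall hp hψ hmaps)

theorem aemeasurable_pullbackMeasure (hp : 1 < p) (hψ : DifferentiableOn ℂ ψ disc)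
    (hmaps : Set.MapsTo ψ disc disc) {f : ℂ → ℂ} (hf : DiffContOnCl ℂ f disc) :
    AEMeasurable f (pullbackMeasure p h ψ) := by
  rw [← Measure.restrict_eq_self_of_ae_mem (pullbackMeasure_ae_mem_closedBall hp hψ hmaps)]
  exact (continuousOn_closedBall_of_diffContOnCl hf).aemeasurable
    Metric.isClosed_closedBall.measurableSet

/-- The points `ψ (r ζ)` need not approach their limit radially, and the limit may lie inside the
disc or on the circle. Continuity of `f` on the closed disc covers every case. -/
theorem ae_radialLimit_weightedComp (hp : 1 < p) (hh : MemHardy p h)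
    (hψ : DifferentiableOn ℂ ψ disc) (hmaps : Set.MapsTo ψ disc disc) {f : ℂ → ℂ}
    (hf : DiffContOnCl ℂ f disc) :
    ∀ᵐ ζ ∂arcMeasure,
      radialLimit (weightedComp h ψ f) ζ = radialLimit h ζ * f (radialLimit ψ ζ) := by
  filter_upwards [arcMeasure_ae_norm, hh.ae_tendsto hp, (memHardy_of_mapsTo hψ hmaps).ae_tendsto hp,
    ae_radialLimit_mem_closedBall hp hψ hmaps] with ζ hζ h1 h2 h3
  have h4 : Tendsto (fun r : ℝ => ψ (r * ζ)) (𝓝[<] 1)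
      (𝓝[Metric.closedBall 0 1] (radialLimit ψ ζ)) := by
    refine tendsto_nhdsWithin_iff.2 ⟨h2, ?_⟩
    filter_upwards [Ioo_mem_nhdsLT (zero_lt_one (α := ℝ))] with r hr
    exact Metric.ball_subset_closedBall (hmaps (mul_mem_disc hr.1.le hr.2 hζ.le))
  exact (h1.mul (((continuousOn_closedBall_of_diffContOnCl hf) _ h3).tendsto.comp h4)).limUnder_eq

/-- The change of variables formula for weighted composition operators. -/
theorem hardyNorm_weightedComp_rpow (hp : 1 < p) (hh : MemHardy p h)
    (hψ : DifferentiableOn ℂ ψ disc) (hmaps : Set.MapsTo ψ disc disc) {f : ℂ → ℂ}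
    (hf : DiffContOnCl ℂ f disc) (hWf : MemHardy p (weightedComp h ψ f)) :
    hardyNorm p (weightedComp h ψ f) ^ p = ∫⁻ z, ‖f z‖ₑ ^ p ∂pullbackMeasure p h ψ := by
  have hfm : AEMeasurable (fun z => ‖f z‖ₑ ^ p) (pullbackMeasure p h ψ) :=
    (aemeasurable_pullbackMeasure hp hψ hmaps hf).enorm.pow_const p
  have hψm := aemeasurable_radialLimit (h := h) hp (memHardy_of_mapsTo hψ hmaps)
  rw [← hWf.eLpNorm_radialLimit hp, eLpNorm_ofReal_rpow hp]
  rw [pullbackMeasure] at hfm ⊢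
  have hcomp : AEMeasurable (fun ζ => ‖f (radialLimit ψ ζ)‖ₑ ^ p)
      (arcMeasure.withDensity fun ζ => ‖radialLimit h ζ‖ₑ ^ p) := hfm.comp_aemeasurable hψm
  rw [lintegral_map' hfm hψm, lintegral_withDensity_eq_lintegral_mul₀'
    (aemeasurable_boundary_weight hp hh) hcomp]
  refine lintegral_congr_ae ?_
  filter_upwards [ae_radialLimit_weightedComp hp hh hψ hmaps hf] with ζ hζ
  rw [hζ, enorm_mul, ENNReal.mul_rpow_of_nonneg _ _ (by linarith)]
  rfl

theorem ae_norm_restrict_circle (μ : Measure ℂ) : ∀ᵐ z ∂μ.restrict circle, ‖z‖ = 1 := by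
  filter_upwards [ae_restrict_mem measurableSet_circle] with z hz
  simpa [circle] using hz

theorem diffContOnCl_polynomial (q : Polynomial ℂ) : DiffContOnCl ℂ (fun z => q.eval z) disc :=
  q.differentiable.diffContOnCl

theorem hardyNorm_rpow_of_diffContOnCl (hp : 1 < p) {f : ℂ → ℂ} (hf : DiffContOnCl ℂ f disc) :
    hardyNorm p f ^ p = ∫⁻ z, ‖f z‖ₑ ^ p ∂arcMeasure := by
  rw [hardyNorm_of_diffContOnCl hp hf, eLpNorm_ofReal_rpow hp]

/-- Boundedness of `W`, tested on polynomials, gives the stronger inequality `μ ≤ C^p m` on the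
circle. -/
theorem restrict_pullbackMeasure_absolutelyContinuous (hp : 1 < p) (hh : MemHardy p h)
    (hψ : DifferentiableOn ℂ ψ disc) (hmaps : Set.MapsTo ψ disc disc) (hW : IsBoundedOp p h ψ) :
    (pullbackMeasure p h ψ).restrict circle ≪ arcMeasure := by
  have := isFiniteMeasure_pullbackMeasure (ψ := ψ) hp hh
  have hp0 : 0 < p := by linarith
  obtain ⟨C, hC⟩ := hW
  have hle : (pullbackMeasure p h ψ).restrict circle ≤ (C ^ p) • arcMeasure := by
    refine measure_le_smul_of_polynomial hp0 (ae_norm_restrict_circle _) arcMeasure_ae_norm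
      fun q => ?_
    have hq := diffContOnCl_polynomial q
    obtain ⟨hWq, hle⟩ := hC _ (memHardy_of_diffContOnCl hp hq)
    rw [← hardyNorm_rpow_of_diffContOnCl hp hq, ENNReal.coe_rpow_of_nonneg _ hp0.le,
      ← ENNReal.mul_rpow_of_nonneg _ _ hp0.le]
    refine (setLIntegral_le_lintegral _ _).trans ?_
    rw [← hardyNorm_weightedComp_rpow hp hh hψ hmaps hq hWq]
    gcongr
  refine (Measure.absolutelyContinuous_of_le hle).trans fun s hs => ?_
  rw [Measure.smul_apply, hs, smul_zero]

/-! ### Bounded below implies density bounded below. -/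

/-- The factor `z^n` has modulus one on the circle and tends to zero inside, so the interior mass
disappears by dominated convergence. -/
theorem tendsto_lintegral_pow_mul (hp : 0 < p) {μ : Measure ℂ}
    (hμ : ∀ᵐ z ∂μ, z ∈ Metric.closedBall (0 : ℂ) 1) (q : Polynomial ℂ)
    (hfin : ∫⁻ z, ‖q.eval z‖ₑ ^ p ∂μ ≠ ∞) :
    Tendsto (fun n : ℕ => ∫⁻ z, ‖(Polynomial.X ^ n * q).eval z‖ₑ ^ p ∂μ) atTop
      (𝓝 (∫⁻ z in circle, ‖q.eval z‖ₑ ^ p ∂μ)) := by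
  rw [← lintegral_indicator measurableSet_circle]
  refine tendsto_lintegral_of_dominated_convergence (fun z => ‖q.eval z‖ₑ ^ p)
    (fun n => (Polynomial.continuous _).measurable.enorm.pow_const p) (fun n => ?_) hfin ?_
  · filter_upwards [hμ] with z hz
    gcongr
    rw [Polynomial.eval_mul, Polynomial.eval_pow, Polynomial.eval_X, enorm_mul, enorm_pow]
    refine mul_le_of_le_one_left zero_le (pow_le_one₀ zero_le ?_)
    rw [← ofReal_norm, ENNReal.ofReal_le_one]
    simpa using hz
  · filter_upwards [hμ] with z hz
    have hz : ‖z‖ ≤ 1 := by simpa using hz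
    simp only [Polynomial.eval_mul, Polynomial.eval_pow, Polynomial.eval_X]
    rcases hz.eq_or_lt with h1 | h1
    · rw [Set.indicator_of_mem (by simpa [circle] using h1)]
      have he : ‖z‖ₑ = 1 := by rw [← ofReal_norm, h1, ENNReal.ofReal_one]
      simp [enorm_mul, enorm_pow, he]
    · rw [Set.indicator_of_notMem (by simpa [circle] using h1.ne)]
      have h2 : Tendsto (fun n : ℕ => z ^ n * q.eval z) atTop (𝓝 0) := by
        simpa using (tendsto_pow_atTop_nhds_zero_of_norm_lt_one h1).mul_const (q.eval z)
      have h3 := (ENNReal.continuous_rpow_const (y := p)).tendsto _ |>.comp h2.enorm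
      simpa [ENNReal.zero_rpow_of_pos hp, Function.comp_def] using h3

theorem IsBoundedBelow.essBoundedAwayFromZero (hp : 1 < p) (hh : MemHardy p h)
    (hψ : DifferentiableOn ℂ ψ disc) (hmaps : Set.MapsTo ψ disc disc) (hW : IsBoundedOp p h ψ)
    (hb : IsBoundedBelow p h ψ) : EssBoundedAwayFromZero (pullbackDensity p h ψ) := by
  have := isFiniteMeasure_pullbackMeasure (ψ := ψ) hp hh
  have hp0 : 0 < p := by linarith
  have hac := restrict_pullbackMeasure_absolutelyContinuous hp hh hψ hmaps hW
  obtain ⟨δ, hδ, hδle⟩ := hb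
  have hδp : δ ^ p ≠ 0 := (NNReal.rpow_pos hδ).ne'
  have hint : ∀ q : Polynomial ℂ, MemHardy p (weightedComp h ψ fun z => q.eval z) := fun q =>
    (hW.choose_spec _ (memHardy_of_diffContOnCl hp (diffContOnCl_polynomial q))).1
  have hstep : ∀ q : Polynomial ℂ, (δ ^ p : ℝ≥0) * ∫⁻ z, ‖q.eval z‖ₑ ^ p ∂arcMeasure ≤
      ∫⁻ z, ‖q.eval z‖ₑ ^ p ∂pullbackMeasure p h ψ := fun q => by
    have hq := diffContOnCl_polynomial q
    rw [← hardyNorm_rpow_of_diffContOnCl hp hq, ENNReal.coe_rpow_of_nonneg _ hp0.le,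
      ← ENNReal.mul_rpow_of_nonneg _ _ hp0.le,
      ← hardyNorm_weightedComp_rpow hp hh hψ hmaps hq (hint q)]
    gcongr
    exact hδle _ (memHardy_of_diffContOnCl hp hq)
  have hcircle : ∀ q : Polynomial ℂ, (δ ^ p : ℝ≥0) * ∫⁻ z, ‖q.eval z‖ₑ ^ p ∂arcMeasure ≤
      ∫⁻ z in circle, ‖q.eval z‖ₑ ^ p ∂pullbackMeasure p h ψ := fun q => by
    -- The lower bound is applied to `z^n q`, whose integral against `m` does not depend on `n`.
    refine ge_of_tendsto' (tendsto_lintegral_pow_mul hp0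
      (pullbackMeasure_ae_mem_closedBall hp hψ hmaps) q ?_) fun n => ?_
    · rw [← hardyNorm_weightedComp_rpow hp hh hψ hmaps (diffContOnCl_polynomial q) (hint q)]
      exact ENNReal.rpow_ne_top_of_nonneg hp0.le (hint q).2.ne
    · refine le_trans (le_of_eq ?_) (hstep (Polynomial.X ^ n * q))
      congr 1
      refine lintegral_congr_ae ?_
      filter_upwards [arcMeasure_ae_norm] with z hz
      have he : ‖z‖ₑ = 1 := by rw [← ofReal_norm, hz, ENNReal.ofReal_one]
      simp [enorm_mul, enorm_pow, he]
  have hle : arcMeasure ≤ (δ ^ p)⁻¹ • (pullbackMeasure p h ψ).restrict circle := by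
    refine measure_le_smul_of_polynomial hp0 arcMeasure_ae_norm (ae_norm_restrict_circle _)
      fun q => ?_
    rw [ENNReal.coe_inv hδp, mul_comm, ← div_eq_mul_inv,
      ENNReal.le_div_iff_mul_le (Or.inl (by exact_mod_cast hδp)) (Or.inl ENNReal.coe_ne_top),
      mul_comm]
    exact hcircle q
  refine ⟨δ ^ p, NNReal.rpow_pos hδ, ?_⟩
  refine ae_le_of_forall_setLIntegral_le_of_sigmaFinite measurable_const fun s hs _ => ?_
  have h1 := Measure.le_iff.1 hle s hs
  rw [setLIntegral_const, pullbackDensity, Measure.setLIntegral_rnDeriv hac]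
  rw [Measure.smul_apply, ENNReal.smul_def, smul_eq_mul, ENNReal.coe_inv hδp, mul_comm,
    ← div_eq_mul_inv, ENNReal.le_div_iff_mul_le (Or.inl (by exact_mod_cast hδp))
      (Or.inl ENNReal.coe_ne_top), mul_comm] at h1
  exact h1

/-! ### Density bounded below implies bounded below. -/

/-- The part of `μ` inside the disc only increases the norm of `W f`, so it can be discarded. -/
theorem mul_hardyNorm_le_of_diffContOnCl (hp : 1 < p) (hh : MemHardy p h)
    (hψ : DifferentiableOn ℂ ψ disc) (hmaps : Set.MapsTo ψ disc disc) (hW : IsBoundedOp p h ψ)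
    {c : ℝ≥0} (hc : ∀ᵐ ζ ∂arcMeasure, (c : ℝ≥0∞) ≤ pullbackDensity p h ψ ζ) {f : ℂ → ℂ}
    (hf : DiffContOnCl ℂ f disc) :
    (c ^ p⁻¹ : ℝ≥0) * hardyNorm p f ≤ hardyNorm p (weightedComp h ψ f) := by
  have := isFiniteMeasure_pullbackMeasure (ψ := ψ) hp hh
  have hp0 : 0 < p := by linarith
  have hac := restrict_pullbackMeasure_absolutelyContinuous hp hh hψ hmaps hW
  obtain ⟨C, hC⟩ := hW
  rw [← ENNReal.rpow_le_rpow_iff hp0, ENNReal.mul_rpow_of_nonneg _ _ hp0.le,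
    ← ENNReal.coe_rpow_of_nonneg _ hp0.le, NNReal.rpow_inv_rpow hp0.ne',
    hardyNorm_rpow_of_diffContOnCl hp hf, hardyNorm_weightedComp_rpow hp hh hψ hmaps hf
      (hC f (memHardy_of_diffContOnCl hp hf)).1]
  have hfm : AEMeasurable (fun z => ‖f z‖ₑ ^ p) arcMeasure :=
    (aestronglyMeasurable_of_continuousOn subset_rfl
      (continuousOn_circle_of_diffContOnCl hf)).enorm.pow_const p
  calc (c : ℝ≥0∞) * ∫⁻ z, ‖f z‖ₑ ^ p ∂arcMeasure
      = ∫⁻ z, c * ‖f z‖ₑ ^ p ∂arcMeasure := (lintegral_const_mul'' _ hfm).symm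
    _ ≤ ∫⁻ z, pullbackDensity p h ψ z * ‖f z‖ₑ ^ p ∂arcMeasure := by
        refine lintegral_mono_ae ?_
        filter_upwards [hc] with z hz
        gcongr
    _ = ∫⁻ z in circle, ‖f z‖ₑ ^ p ∂pullbackMeasure p h ψ := lintegral_rnDeriv_mul hac hfm
    _ ≤ _ := setLIntegral_le_lintegral _ _

theorem hardyNorm_add_le (hp : 1 < p) {f g : ℂ → ℂ} (hf : DifferentiableOn ℂ f disc)
    (hg : DifferentiableOn ℂ g disc) :
    hardyNorm p (fun z => f z + g z) ≤ hardyNorm p f + hardyNorm p g := by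
  refine iSup₂_le fun r hr => ?_
  refine (eLpNorm_add_le (memLp_dilate hf hr.1 hr.2 (ENNReal.ofReal p)).1
    (memLp_dilate hg hr.1 hr.2 (ENNReal.ofReal p)).1 (by simpa using hp.le)).trans ?_
  gcongr
  · exact eLpNorm_dilate_le_hardyNorm hr.1 hr.2
  · exact eLpNorm_dilate_le_hardyNorm hr.1 hr.2

/-- This converts the `L^p` convergence of dilates on the circle into convergence in the Hardy norm,
where the boundedness of `W` can be used. -/
theorem MemHardy.dilate_sub (hp : 1 < p) {f : ℂ → ℂ} (hf : MemHardy p f) (n : ℕ) :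
    MemHardy p (fun z => f (radius n * z) - f z) ∧
      hardyNorm p (fun z => f (radius n * z) - f z) =
        eLpNorm (fun ζ : ℂ => f (radius n * ζ) - radialLimit f ζ) (ENNReal.ofReal p)
          arcMeasure := by
  have hd := diffContOnCl_dilate hf.1 (radius_nonneg n) (radius_lt_one n)
  have hneg : hardyNorm p (fun z => -f z) = hardyNorm p f := by
    simp only [hardyNorm]
    refine iSup_congr fun r => iSup_congr fun _ => ?_
    exact eLpNorm_neg (fun ζ : ℂ => f (r * ζ)) _ _
  have hmem : MemHardy p (fun z => f (radius n * z) - f z) := by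
    refine ⟨hd.differentiableOn.sub hf.1, ?_⟩
    simp_rw [sub_eq_add_neg]
    refine (hardyNorm_add_le hp hd.differentiableOn hf.1.neg).trans_lt ?_
    rw [ENNReal.add_lt_top]
    exact ⟨(memHardy_of_diffContOnCl hp hd).2, hneg ▸ hf.2⟩
  refine ⟨hmem, ?_⟩
  rw [← hmem.eLpNorm_radialLimit hp]
  refine eLpNorm_congr_ae ?_
  filter_upwards [arcMeasure_ae_norm, hf.ae_tendsto hp,
    (memHardy_of_diffContOnCl hp hd).ae_tendsto hp] with ζ hζ h1 h2
  rw [radialLimit_of_diffContOnCl hd hζ] at h2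
  exact (h2.sub h1).limUnder_eq

/-- The estimate holds for the dilates `f_n`. Writing `W f_n = W f + W (f_n - f)`, with the last
term bounded by `C ‖f_n - f‖`, passes it to `f` without any boundary values of `f ∘ ψ`. -/
theorem isBoundedBelow_of_essBoundedAwayFromZero (hp : 1 < p) (hh : MemHardy p h)
    (hψ : DifferentiableOn ℂ ψ disc) (hmaps : Set.MapsTo ψ disc disc) (hW : IsBoundedOp p h ψ)
    (hg : EssBoundedAwayFromZero (pullbackDensity p h ψ)) : IsBoundedBelow p h ψ := by
  obtain ⟨c, hc0, hc⟩ := hg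
  refine ⟨c ^ p⁻¹, NNReal.rpow_pos hc0, fun f hf => ?_⟩
  have hd := fun n => diffContOnCl_dilate hf.1 (radius_nonneg n) (radius_lt_one n)
  have hlower := fun n => mul_hardyNorm_le_of_diffContOnCl hp hh hψ hmaps hW hc (hd n)
  obtain ⟨C, hC⟩ := hW
  have hupper : ∀ n, hardyNorm p (weightedComp h ψ fun z => f (radius n * z)) ≤
      hardyNorm p (weightedComp h ψ f) + C * eLpNorm (fun ζ : ℂ => f (radius n * ζ) -
        radialLimit f ζ) (ENNReal.ofReal p) arcMeasure := fun n => by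
    obtain ⟨hmem, heq⟩ := hf.dilate_sub hp n
    rw [← heq]
    have e : weightedComp h ψ (fun z => f (radius n * z)) = fun z => weightedComp h ψ f z +
        weightedComp h ψ (fun z => f (radius n * z) - f z) z := by
      funext z
      simp only [weightedComp]
      ring
    rw [e]
    refine (hardyNorm_add_le hp (hC f hf).1.1 (hC _ hmem).1.1).trans ?_
    gcongr
    exact (hC _ hmem).2
  have hlim1 : Tendsto (fun n => (c ^ p⁻¹ : ℝ≥0) * hardyNorm p fun z => f (radius n * z)) atTop
      (𝓝 ((c ^ p⁻¹ : ℝ≥0) * hardyNorm p f)) := by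
    simp_rw [fun n => hardyNorm_of_diffContOnCl hp (hd n)]
    exact ENNReal.Tendsto.const_mul (tendsto_eLpNorm_radius hp hf.1) (Or.inr ENNReal.coe_ne_top)
  have hlim2 : Tendsto (fun n => hardyNorm p (weightedComp h ψ f) + C * eLpNorm (fun ζ : ℂ =>
      f (radius n * ζ) - radialLimit f ζ) (ENNReal.ofReal p) arcMeasure) atTop
      (𝓝 (hardyNorm p (weightedComp h ψ f))) := by
    simpa using tendsto_const_nhds.add
      (ENNReal.Tendsto.const_mul (hf.fatou hp).2.2 (Or.inr (ENNReal.coe_ne_top (r := C))))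
  exact le_of_tendsto_of_tendsto' hlim1 hlim2 fun n => (hlower n).trans (hupper n)

end Pullback

end HardyDisc

theorem mainTheorem5 (p : ℝ) (hp : 1 < p) (h ψ : ℂ → ℂ)
    (hh : HardyDisc.MemHardy p h)
    (hψ : DifferentiableOn ℂ ψ HardyDisc.disc)
    (hψ_maps : Set.MapsTo ψ HardyDisc.disc HardyDisc.disc)
    (hW : HardyDisc.IsBoundedOp p h ψ) :
    (HardyDisc.pullbackMeasure p h ψ).restrict HardyDisc.circle ≪ HardyDisc.arcMeasure ∧
    (HardyDisc.IsBoundedBelow p h ψ ↔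
      HardyDisc.EssBoundedAwayFromZero (HardyDisc.pullbackDensity p h ψ)) :=
  ⟨HardyDisc.restrict_pullbackMeasure_absolutelyContinuous hp hh hψ hψ_maps hW,
    fun hb => hb.essBoundedAwayFromZero hp hh hψ hψ_maps hW,
    HardyDisc.isBoundedBelow_of_essBoundedAwayFromZero hp hh hψ hψ_maps hW⟩
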